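/- Let $M,K\in\mathbb{R}^{n\times n}$ be symmetric positive definite and let $D_{ij},R_{ij}\in\mathbb{R}^{n\times n}$ ($i,j=1,\dots,q$) be symmetric positive semidefinite with $D_{ij}=D_{ji}$, $R_{ij}=R_{ji}$, $D_{ii}=R_{ii}=0$, and $R_{ij}\ne 0$ for at least one pair $(i,j)$. For $\varepsilon>0$ consider the array $$M\ddot x_i+Kx_i+\sum_{j=1}^q D_{ij}(\dot x_i-\dot x_j)+\varepsilon\sum_{j=1}^q R_{ij}(x_i-x_j)=0,\qquad i=1,\dots,q, \qquad (*)$$ with $x_i(t)\in\mathbb{R}^n$. It synchronizes if $\|x_i(t)-x_j(t)\|\to0$ as $t\to\infty$ for all $i,j$ and every solution. Suppose that the eigenvalues $\sigma_1,\dots,\sigma_n$ of $P=M^{-1/2}KM^{-1/2}$ are distinct, and let $v_1,\dots,v_n\in\mathbb{R}^n$ be corresponding unit eigenvectors. For weights $W_{ij}$ with $W_{ii}=0$, let $\mathrm{lap}(W_{ij})$ be the $q\times q$ block matrix with diagonal blocks $\sum_jW_{ij}$ and off-diagonal blocks $-W_{ij}$. Put $L_d=\mathrm{lap}(M^{-1/2}D_{ij}M^{-1/2})$,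 $L_r=\mathrm{lap}(M^{-1/2}R_{ij}M^{-1/2})$, and $$G_{k\ell}=[I_q\otimes v_k^T]L_d[I_q\otimes v_\ell],\qquad B_{k\ell}=[I_q\otimes v_k^T]L_r[I_q\otimes v_\ell]\qquad(k,\ell=1,\dots,n),$$ and let $G=(G_{k\ell})$, $B=(B_{k\ell})$ be the $nq\times nq$ matrices with these blocks. For a square complex matrix $X$, let $\lambda_k(X)$ be its $k$th eigenvalue, counted with algebraic multiplicity, in nondecreasing order of real part; $\|\cdot\|$ is the (induced) $2$-norm. Define $$\bar\sigma=\tfrac12\min_{k\ne\ell}|\sigma_k-\sigma_\ell|,\qquad \bar\mu=\tfrac12\min_k\ \min_{\lambda\neq\lambda'}|\lambda-\lambda'|,$$ where the inner minimum is over distinct eigenvalues $\lambda,\lambda'$ of $B_{kk}$ (and is $+\infty$ if there is only one), and $$\bar\gamma=\Big[\min_k\min_{w\in\mathcal C_k}w^*G_{kk}w\Big]^{1/2},\qquad \mathcal C_k=\Big\{w\in\mathbb{C}^q:\|w\|=1,\ B_{kk}w=\mu w\text{ for some }\mu\in\mathbb{R},\ \sum_i w_i=0\Big\}.$$ Theorem.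 Suppose $\mathrm{Re}\,\lambda_2(G_{kk}+jB_{kk})>0$ for all $k=1,\dots,n$, where $j=\sqrt{-1}$. Then there exists $r>0$ such that the array $(*)$ synchronizes for all $\varepsilon\in(0,r)$. In particular, if $n\ge2$, one can choose $$r=\frac{\bar\gamma\,\bar\sigma\,\bar\mu}{\big(\sqrt{\|G\|}+2\bar\gamma\big)\sqrt{n-1}\,\|B\|\,(\bar\mu+\|B\|)},$$ which is positive; if $n=1$, one can choose $r=+\infty$, i.e. $(*)$ synchronizes for every $\varepsilon>0$. -/

import Mathlib

open Matrix Filter Topology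

noncomputable section

namespace OscArray

/-- `x = (x₁, …, x_q)` solves, on the time interval `[0, ∞)`,
`M ẍᵢ + K xᵢ + ∑ⱼ Dᵢⱼ (ẋᵢ - ẋⱼ) + ∑ⱼ Rᵢⱼ (xᵢ - xⱼ) = 0` for all `i`
(`v` and `a` are the first and the second time derivative of `x`). -/
def IsSolution {q n : ℕ} (M K : Matrix (Fin n) (Fin n) ℝ)
    (D R : Fin q → Fin q → Matrix (Fin n) (Fin n) ℝ)
    (x : Fin q → ℝ → EuclideanSpace ℝ (Fin n)) : Prop :=
  ∃ v a : Fin q → ℝ → EuclideanSpace ℝ (Fin n),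
    ∀ i, ∀ t ∈ Set.Ici (0 : ℝ),
      HasDerivWithinAt (x i) (v i t) (Set.Ici 0) t ∧
      HasDerivWithinAt (v i) (a i t) (Set.Ici 0) t ∧
      M *ᵥ (a i t).ofLp + K *ᵥ (x i t).ofLp
        + ∑ j, D i j *ᵥ (v i t - v j t).ofLp
        + ∑ j, R i j *ᵥ (x i t - x j t).ofLp = 0

/-- The array synchronizes: `‖xᵢ(t) - xⱼ(t)‖ → 0` as `t → ∞` for all `i, j`
and for every solution, that is, for all initial conditions. -/
def Synchronizes {q n : ℕ} (M K : Matrix (Fin n) (Fin n) ℝ)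
    (D R : Fin q → Fin q → Matrix (Fin n) (Fin n) ℝ) : Prop :=
  ∀ x : Fin q → ℝ → EuclideanSpace ℝ (Fin n), IsSolution M K D R x →
    ∀ i j, Tendsto (fun t => ‖x i t - x j t‖) atTop (𝓝 0)

/-- `M^{-1/2}`: the inverse of the positive semidefinite square root of `M`. -/
def invSqrt {n : ℕ} (M : Matrix (Fin n) (Fin n) ℝ) : Matrix (Fin n) (Fin n) ℝ :=
  open scoped MatrixOrder in (CFC.sqrt M)⁻¹

/-- `P = M^{-1/2} K M^{-1/2}`. -/
def normalizedStiffness {n : ℕ} (M K : Matrix (Fin n) (Fin n) ℝ) :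
    Matrix (Fin n) (Fin n) ℝ :=
  invSqrt M * K * invSqrt M

/-- The matrix-weighted Laplacian `lap (Wᵢⱼ)`: a `q × q` array of `n × n` blocks, with
diagonal blocks `∑ⱼ Wᵢⱼ` and off-diagonal blocks `-Wᵢⱼ` (for weights with `Wᵢᵢ = 0`). -/
def lap {q n : ℕ} (W : Fin q → Fin q → Matrix (Fin n) (Fin n) ℝ) :
    Matrix (Fin q × Fin n) (Fin q × Fin n) ℝ :=
  Matrix.of fun p r =>
    if p.1 = r.1 then (∑ j, W p.1 j) p.2 r.2 else -(W p.1 r.1 p.2 r.2)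

/-- `lap (M^{-1/2} Wᵢⱼ M^{-1/2})`: this is `L_d` for `W = D` and `L_r` for `W = R`. -/
def couplingLap {q n : ℕ} (M : Matrix (Fin n) (Fin n) ℝ)
    (W : Fin q → Fin q → Matrix (Fin n) (Fin n) ℝ) :
    Matrix (Fin q × Fin n) (Fin q × Fin n) ℝ :=
  lap fun i j => invSqrt M * W i j * invSqrt M

/-- The `qn × q` matrix `I_q ⊗ v` for a column vector `v ∈ ℝⁿ`. -/
def idKron (q : ℕ) {n : ℕ} (v : EuclideanSpace ℝ (Fin n)) :
    Matrix (Fin q × Fin n) (Fin q) ℝ :=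
  Matrix.of fun p j => (1 : Matrix (Fin q) (Fin q) ℝ) p.1 j * v p.2

/-- The `q × q` block `[I_q ⊗ v_kᵀ] L [I_q ⊗ v_l]`:
this is `G_kl` for `L = L_d` and `B_kl` for `L = L_r`. -/
def modalBlock {q n : ℕ} (L : Matrix (Fin q × Fin n) (Fin q × Fin n) ℝ)
    (v : Fin n → EuclideanSpace ℝ (Fin n)) (k l : Fin n) : Matrix (Fin q) (Fin q) ℝ :=
  (idKron q (v k))ᵀ * L * idKron q (v l)

/-- The `nq × nq` matrix with the blocks `modalBlock L v k l`:
this is `G` for `L = L_d` and `B` for `L = L_r`. -/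
def modalMatrix {q n : ℕ} (L : Matrix (Fin q × Fin n) (Fin q × Fin n) ℝ)
    (v : Fin n → EuclideanSpace ℝ (Fin n)) : Matrix (Fin n × Fin q) (Fin n × Fin q) ℝ :=
  Matrix.of fun p r => modalBlock L v p.1 r.1 p.2 r.2

/-- `Re λ_k(X)`: the `k`-th smallest (`k = 1, 2, …`) of the real parts of the eigenvalues of
the complex matrix `X`, counted with algebraic multiplicity
(a meaningful value for `1 ≤ k ≤` size of `X`). -/
def reEigenvalue {m : ℕ} (X : Matrix (Fin m) (Fin m) ℂ) (k : ℕ) : ℝ :=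
  ((X.charpoly.roots.map Complex.re).sort (· ≤ ·)).getD (k - 1) 0

/-- The complex matrix `G + jB`. -/
def admittance {q : ℕ} (G B : Matrix (Fin q) (Fin q) ℝ) : Matrix (Fin q) (Fin q) ℂ :=
  G.map Complex.ofReal + Complex.I • B.map Complex.ofReal

/-- The norm of a real matrix induced by the Euclidean norm of vectors. -/
def norm2 {ι : Type*} [Fintype ι] [DecidableEq ι] (X : Matrix ι ι ℝ) : ℝ :=
  ‖Matrix.toEuclideanCLM (𝕜 := ℝ) X‖

/-- `σ̄ = ½ min_{k ≠ l} |σ_k - σ_l|`. -/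
def sigmaBar {n : ℕ} (σ : Fin n → ℝ) : ℝ :=
  (1 / 2) * sInf {d | ∃ k l, k ≠ l ∧ d = |σ k - σ l|}

/-- `μ̄ = ½ min_k min |λ - λ'|`, the inner minimum over the pairs of distinct eigenvalues of
`B_k` (an index `k` whose `B_k` has only one eigenvalue does not contribute). -/
def muBar {q n : ℕ} (B : Fin n → Matrix (Fin q) (Fin q) ℝ) : ℝ :=
  (1 / 2) * sInf {d | ∃ k, ∃ a ∈ spectrum ℝ (B k), ∃ b ∈ spectrum ℝ (B k),
    a ≠ b ∧ d = |a - b|}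

/-- The unit vector `[1 1 ⋯ 1]ᵀ / √q`. -/
def oneVec (q : ℕ) : Fin q → ℂ := fun _ => ((1 / Real.sqrt q : ℝ) : ℂ)

/-- The set of the unit vectors `w ∈ ℂ^q` with `B w = μ w` for some real `μ`
and `1_qᵀ w = 0`. -/
def unitEigenvectors {q : ℕ} (B : Matrix (Fin q) (Fin q) ℝ) : Set (EuclideanSpace ℂ (Fin q)) :=
  {w | ‖w‖ = 1 ∧
    (∃ μ : ℝ, (B.map Complex.ofReal - (μ : ℂ) • (1 : Matrix (Fin q) (Fin q) ℂ)) *ᵥ w.ofLp = 0) ∧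
    oneVec q ⬝ᵥ w.ofLp = 0}

/-- `γ̄ = (min_k min_{w ∈ C_k} w* G_k w)^{1/2}`, where `C_k = unitEigenvectors (B k)`. -/
def gammaBar {q n : ℕ} (G B : Fin n → Matrix (Fin q) (Fin q) ℝ) : ℝ :=
  Real.sqrt (sInf {c | ∃ k, ∃ w ∈ unitEigenvectors (B k),
    c = (star w.ofLp ⬝ᵥ ((G k).map Complex.ofReal *ᵥ w.ofLp)).re})

/-- The explicit coupling bound
`γ̄ σ̄ μ̄ / ((√‖G‖ + 2 γ̄) √(n-1) ‖B‖ (μ̄ + ‖B‖))`, with `G`, `B` built from `L_d`, `L_r` and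
the eigenvectors `v`; meaningful for `n ≥ 2`. -/
def couplingBound {q n : ℕ} (Ld Lr : Matrix (Fin q × Fin n) (Fin q × Fin n) ℝ)
    (σ : Fin n → ℝ) (v : Fin n → EuclideanSpace ℝ (Fin n)) : ℝ :=
  let γ := gammaBar (fun k => modalBlock Ld v k k) (fun k => modalBlock Lr v k k)
  let s := sigmaBar σ
  let μ := muBar fun k => modalBlock Lr v k k
  let g := norm2 (modalMatrix Ld v)
  let b := norm2 (modalMatrix Lr v)
  γ * s * μ / ((Real.sqrt g + 2 * γ) * Real.sqrt ((n : ℝ) - 1) * b * (μ + b))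

end OscArray

end

/-!
Energy is dissipated except along motions invisible to the damping, so the array synchronizes
unless it has an undamped oscillation `cos(√ν t) u` that is not synchronous. In the coordinates
given by the modes `v_k` such a `u` satisfies `(diag(σ) + ε B) u = ν u`, `G u = 0` and has mean
zero in each mode. Since the `σ_k` are separated by `2σ̄` and the eigenvalues of each `B_kk` by
`2μ̄`, a first order perturbation argument places `u` at distance `O(ε) ‖u‖` from an eigenvector
`w` of a single block `B_kk`, again with mean zero. Then `G u = 0` makes `wᵀ G_kk w` at most
`‖G‖ ‖u - w‖²`, whereas it is at least `γ̄² ‖w‖²`; for small `ε` this leaves only `u = 0`.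

The hypothesis on `λ₂` enters through `γ̄ > 0`. If `w* G_kk w = 0` for some `w ∈ C_k`, then
`G_kk w = 0`, so that `w` and `(1, …, 1)` are independent eigenvectors of `G_kk + j B_kk` to
imaginary eigenvalues, and `Re λ₂ ≤ 0`.
-/

namespace OscArray

/-! ### Asymptotically stable linear differential equations -/

section LinearODE

variable {E : Type*} [NormedAddCommGroup E] [NormedSpace ℂ E]

lemma norm_le_of_hasDerivWithinAt_smul_add {f g : ℝ → E} {c : ℂ} {T δ : ℝ}
    (hf : ∀ t ∈ Set.Ici T, HasDerivWithinAt f (c • f t + g t) (Set.Ici T) t)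
    (hg : ∀ t ∈ Set.Ici T, ‖g t‖ ≤ -c.re * δ) {t : ℝ} (ht : T ≤ t) :
    ‖f t‖ ≤ Real.exp (c.re * (t - T)) * (‖f T‖ - δ) + δ := by
  -- The integrating factor `φ` turns `f` into a function whose derivative is the forcing alone.
  let φ : ℝ → ℂ := fun s => Complex.exp (-c * (s - T))
  have hφ (s : ℝ) : HasDerivAt φ (φ s * -c) s := by
    have h := ((hasDerivAt_id (s : ℂ)).sub_const (T : ℂ)).const_mul (-c)
    simpa [φ] using h.cexp.comp_ofReal
  have hnorm (s : ℝ) : ‖φ s‖ = Real.exp (-c.re * (s - T)) := by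
    simp [φ, Complex.norm_exp]
  have hF (s : ℝ) (hs : s ∈ Set.Ici T) :
      HasDerivWithinAt (fun s => φ s • f s) (φ s • g s) (Set.Ici T) s := by
    refine ((hφ s).hasDerivWithinAt.smul (hf s hs)).congr_deriv ?_
    module
  have hB (s : ℝ) : HasDerivAt (fun s => ‖f T‖ - δ + δ * Real.exp (-c.re * (s - T)))
      (δ * (Real.exp (-c.re * (s - T)) * -c.re)) s := by
    have h := ((hasDerivAt_id s).sub_const T).const_mul (-c.re)
    simpa using (h.exp.const_mul δ).const_add (‖f T‖ - δ)
  have key : ‖φ t • f t‖ ≤ ‖f T‖ - δ + δ * Real.exp (-c.re * (t - T)) := by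
    refine image_norm_le_of_norm_deriv_right_le_deriv_boundary (a := T) (b := t)
      (fun s hs => ((hF s hs.1).mono Set.Icc_subset_Ici_self).continuousWithinAt)
      (fun s hs => (hF s hs.1).mono (Set.Ici_subset_Ici.2 hs.1)) ?_ hB (fun s hs => ?_)
      (Set.right_mem_Icc.2 ht)
    · simp [φ]
    · rw [norm_smul, hnorm]
      nlinarith [hg s hs.1, Real.exp_pos (-c.re * (s - T))]
  rw [norm_smul, hnorm] at key
  have hexp : Real.exp (c.re * (t - T)) * Real.exp (-c.re * (t - T)) = 1 := by
    rw [← Real.exp_add]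
    simp
  calc ‖f t‖ = Real.exp (c.re * (t - T)) * (Real.exp (-c.re * (t - T)) * ‖f t‖) := by
        rw [← mul_assoc, hexp, one_mul]
    _ ≤ Real.exp (c.re * (t - T)) * (‖f T‖ - δ + δ * Real.exp (-c.re * (t - T))) := by gcongr
    _ = _ := by linear_combination δ * hexp

lemma tendsto_zero_of_hasDerivWithinAt_smul_add {f g : ℝ → E} {c : ℂ} (hc : c.re < 0)
    (hf : ∀ t ∈ Set.Ici (0 : ℝ), HasDerivWithinAt f (c • f t + g t) (Set.Ici 0) t)
    (hg : Tendsto g atTop (𝓝 0)) : Tendsto f atTop (𝓝 0) := by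
  rw [Metric.tendsto_nhds]
  intro ε hε
  have hg_small : ∀ᶠ t in atTop, ‖g t‖ < -c.re * (ε / 2) :=
    hg.norm.eventually_lt_const (by rw [norm_zero]; nlinarith)
  obtain ⟨T, hT⟩ := eventually_atTop.1 (hg_small.and (eventually_ge_atTop 0))
  have hT0 : 0 ≤ T := (hT T le_rfl).2
  have hbound (t : ℝ) (ht : T ≤ t) :
      ‖f t‖ ≤ Real.exp (c.re * (t - T)) * (‖f T‖ - ε / 2) + ε / 2 :=
    norm_le_of_hasDerivWithinAt_smul_add
      (fun s hs => (hf s (hT0.trans hs)).mono (Set.Ici_subset_Ici.2 hT0))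
      (fun s hs => (hT s hs).1.le) ht
  have hdecay : Tendsto (fun t => Real.exp (c.re * (t - T)) * (‖f T‖ - ε / 2)) atTop (𝓝 0) := by
    have h : Tendsto (fun t => c.re * (t - T)) atTop atBot :=
      (tendsto_atTop_add_const_right _ (-T) tendsto_id).const_mul_atTop_of_neg hc
    simpa using (Real.tendsto_exp_atBot.comp h).mul_const (‖f T‖ - ε / 2)
  filter_upwards [hdecay.eventually_lt_const (half_pos hε), eventually_ge_atTop T] with t ht htT
  rw [dist_zero_right]
  linarith [hbound t htT]

lemma tendsto_zero_of_aeval_prod_apply_eq_zero (A : E →L[ℂ] E) (s : Multiset ℂ)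
    (hs : ∀ c ∈ s, c.re < 0) (X : ℝ → E)
    (hX : ∀ t ∈ Set.Ici (0 : ℝ), HasDerivWithinAt X (A (X t)) (Set.Ici 0) t)
    (hprod : ∀ t ∈ Set.Ici (0 : ℝ), Polynomial.aeval (A : Module.End ℂ E)
      (s.map fun c => Polynomial.X - Polynomial.C c).prod (X t) = 0) :
    Tendsto X atTop (𝓝 0) := by
  induction s using Multiset.induction generalizing X with
  | empty =>
    refine tendsto_const_nhds.congr' ?_
    filter_upwards [eventually_ge_atTop 0] with t ht
    simpa using (hprod t ht).symm
  | cons c s ih =>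
    have hY : Tendsto (fun t => A (X t) - c • X t) atTop (𝓝 0) := by
      refine ih (fun d hd => hs d (Multiset.mem_cons_of_mem hd)) _ (fun t ht => ?_)
        (fun t ht => ?_)
      · rw [map_sub, map_smul]
        exact ((A.restrictScalars ℝ).hasFDerivAt.comp_hasDerivWithinAt t (hX t ht)).sub
          ((hX t ht).const_smul c)
      · have h := hprod t ht
        rw [Multiset.map_cons, Multiset.prod_cons, mul_comm, map_mul] at h
        simpa [Algebra.algebraMap_eq_smul_one] using h
    refine tendsto_zero_of_hasDerivWithinAt_smul_add (hs c (Multiset.mem_cons_self c s))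
      (fun t ht => ?_) hY
    rw [add_sub_cancel]
    exact hX t ht

theorem tendsto_zero_of_hasEigenvalue_re_neg [FiniteDimensional ℂ E] (A : E →L[ℂ] E)
    (hA : ∀ c, Module.End.HasEigenvalue (A : Module.End ℂ E) c → c.re < 0) (X : ℝ → E)
    (hX : ∀ t ∈ Set.Ici (0 : ℝ), HasDerivWithinAt X (A (X t)) (Set.Ici 0) t) :
    Tendsto X atTop (𝓝 0) := by
  have hint : IsIntegral ℂ (A : Module.End ℂ E) := Algebra.IsIntegral.isIntegral _
  refine tendsto_zero_of_aeval_prod_apply_eq_zero A (minpoly ℂ (A : Module.End ℂ E)).roots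
    (fun c hc => hA c (Module.End.hasEigenvalue_of_isRoot ?_)) X hX (fun t _ => ?_)
  · exact (Polynomial.mem_roots (minpoly.ne_zero hint)).1 hc
  · rw [← (IsAlgClosed.splits _).eq_prod_roots_of_monic (minpoly.monic hint), minpoly.aeval,
      LinearMap.zero_apply]

end LinearODE

/-! ### Complexification of real matrices -/

section Complexification

open scoped ComplexOrder

variable {ι κ : Type*}

lemma re_map_ofReal_mulVec [Fintype κ] (A : Matrix ι κ ℝ) (u : κ → ℂ) (i : ι) :
    ((A.map Complex.ofReal *ᵥ u) i).re = (A *ᵥ fun j => (u j).re) i := by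
  simp [mulVec, dotProduct]

lemma im_map_ofReal_mulVec [Fintype κ] (A : Matrix ι κ ℝ) (u : κ → ℂ) (i : ι) :
    ((A.map Complex.ofReal *ᵥ u) i).im = (A *ᵥ fun j => (u j).im) i := by
  simp [mulVec, dotProduct]

lemma map_ofReal_mulVec_ofReal [Fintype κ] (A : Matrix ι κ ℝ) (x : κ → ℝ) :
    A.map Complex.ofReal *ᵥ (fun j => (x j : ℂ)) = fun i => ((A *ᵥ x) i : ℂ) := by
  ext i
  simp [mulVec, dotProduct]

open scoped MatrixOrder in
lemma posSemidef_map_ofReal [Finite κ] {A : Matrix κ κ ℝ} (hA : A.PosSemidef) :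
    (A.map Complex.ofReal).PosSemidef := by
  classical
  cases nonempty_fintype κ
  obtain ⟨B, rfl⟩ := CStarAlgebra.nonneg_iff_eq_star_mul_self.1 hA.nonneg
  have h : (star B * B).map Complex.ofReal
      = (B.map Complex.ofReal)ᴴ * B.map Complex.ofReal := by
    ext i j
    simp [mul_apply, star_eq_conjTranspose]
  rw [h]
  exact posSemidef_conjTranspose_mul_self _

lemma posDef_map_ofReal [Finite κ] {A : Matrix κ κ ℝ} (hA : A.PosDef) :
    (A.map Complex.ofReal).PosDef := by
  classical
  cases nonempty_fintype κ
  exact (posSemidef_map_ofReal hA.posSemidef).posDef_iff_isUnit.2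
    (hA.isUnit.map Complex.ofRealHom.mapMatrix)

end Complexification

/-! ### Damped oscillators -/

section DampedOscillator

open scoped ComplexOrder

variable {𝕜 ι : Type*} [RCLike 𝕜] [Fintype ι]

/-- `z` is a motion of the damped oscillator `M z̈ + G ż + H z = 0` on the time interval
`[0, ∞)`; `w` and `a` are its velocity and acceleration. -/
def IsDampedOscillation (M H G : Matrix ι ι 𝕜) (z : ℝ → ι → 𝕜) : Prop :=
  ∃ w a : ℝ → ι → 𝕜, ∀ t ∈ Set.Ici (0 : ℝ),
    HasDerivWithinAt z (w t) (Set.Ici 0) t ∧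
    HasDerivWithinAt w (a t) (Set.Ici 0) t ∧
    M *ᵥ a t + G *ᵥ w t + H *ᵥ z t = 0

/-- The oscillator `M z̈ + G ż + H z = 0` has no undamped mode: the damping vanishes on no
eigenvector of the pencil `H - ν M`. Only real `ν` are considered, which is enough because the
eigenvalues of a pencil with `M` positive definite and `H` Hermitian are real. -/
def HasNoUndampedMode (M H G : Matrix ι ι 𝕜) : Prop :=
  ∀ (ν : ℝ) (u : ι → 𝕜), H *ᵥ u = ν • M *ᵥ u → G *ᵥ u = 0 → u = 0

lemma HasNoUndampedMode.map_ofReal {M H G : Matrix ι ι ℝ} (h : HasNoUndampedMode M H G) :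
    HasNoUndampedMode (M.map Complex.ofReal) (H.map Complex.ofReal)
      (G.map Complex.ofReal) := by
  intro ν u hHu hGu
  have hre : (fun i => (u i).re) = 0 := by
    refine h ν _ (funext fun i => ?_) (funext fun i => ?_)
    · simpa [re_map_ofReal_mulVec] using congrArg Complex.re (congrFun hHu i)
    · simpa [re_map_ofReal_mulVec] using congrArg Complex.re (congrFun hGu i)
  have him : (fun i => (u i).im) = 0 := by
    refine h ν _ (funext fun i => ?_) (funext fun i => ?_)
    · simpa [im_map_ofReal_mulVec] using congrArg Complex.im (congrFun hHu i)
    · simpa [im_map_ofReal_mulVec] using congrArg Complex.im (congrFun hGu i)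
  exact funext fun i => Complex.ext (congrFun hre i) (congrFun him i)

lemma IsDampedOscillation.map_ofReal {M H G : Matrix ι ι ℝ} {z : ℝ → ι → ℝ}
    (hz : IsDampedOscillation M H G z) :
    IsDampedOscillation (M.map Complex.ofReal) (H.map Complex.ofReal) (G.map Complex.ofReal)
      fun t i => (z t i : ℂ) := by
  obtain ⟨w, a, h⟩ := hz
  refine ⟨fun t i => w t i, fun t i => a t i, fun t ht => ?_⟩
  obtain ⟨hz, hw, heq⟩ := h t ht
  refine ⟨hasDerivWithinAt_pi.2 fun i => (hasDerivWithinAt_pi.1 hz i).ofReal_comp,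
    hasDerivWithinAt_pi.2 fun i => (hasDerivWithinAt_pi.1 hw i).ofReal_comp, ?_⟩
  ext i
  simpa [map_ofReal_mulVec_ofReal] using congrArg Complex.ofReal (congrFun heq i)

lemma IsDampedOscillation.mulVec {M H G : Matrix ι ι 𝕜} {z : ℝ → ι → 𝕜}
    (hz : IsDampedOscillation M H G z) {C G' : Matrix ι ι 𝕜} (hM : Commute M C)
    (hH : Commute H C) (hG : G' * C = C * G) :
    IsDampedOscillation M H G' fun t => C *ᵥ z t := by
  obtain ⟨w, a, h⟩ := hz
  have hderiv {y : ℝ → ι → 𝕜} {y' : ι → 𝕜} {t : ℝ}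
      (hy : HasDerivWithinAt y y' (Set.Ici 0) t) :
      HasDerivWithinAt (fun t => C *ᵥ y t) (C *ᵥ y') (Set.Ici 0) t :=
    ((LinearMap.toContinuousLinearMap C.mulVecLin).restrictScalars ℝ).hasFDerivAt
      |>.comp_hasDerivWithinAt t hy
  refine ⟨fun t => C *ᵥ w t, fun t => C *ᵥ a t, fun t ht => ?_⟩
  obtain ⟨hz, hw, heq⟩ := h t ht
  refine ⟨hderiv hz, hderiv hw, ?_⟩
  simp only [mulVec_mulVec, hM.eq, hH.eq, hG]
  simp only [← mulVec_mulVec, ← mulVec_add, heq, mulVec_zero]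

lemma hasNoUndampedMode_add {M H G A : Matrix ι ι 𝕜} (hG : G.PosSemidef) (hA : A.PosSemidef)
    (h : ∀ (ν : ℝ) (u : ι → 𝕜), H *ᵥ u = ν • M *ᵥ u → G *ᵥ u = 0 → A *ᵥ u = 0 → u = 0) :
    HasNoUndampedMode M H (G + A) := by
  intro ν u hHu hu
  have hsum : star u ⬝ᵥ G *ᵥ u + star u ⬝ᵥ A *ᵥ u = 0 := by
    rw [← dotProduct_add, ← add_mulVec, hu, dotProduct_zero]
  obtain ⟨hGu, hAu⟩ := (add_eq_zero_iff_of_nonneg (hG.dotProduct_mulVec_nonneg u)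
    (hA.dotProduct_mulVec_nonneg u)).1 hsum
  exact h ν u hHu ((hG.dotProduct_mulVec_zero_iff u).1 hGu)
    ((hA.dotProduct_mulVec_zero_iff u).1 hAu)

lemma re_neg_or_of_quadratic_eq_zero {m g h : ℝ} (hm : 0 < m) (hg : 0 ≤ g) (hh : 0 < h) {c : ℂ}
    (hc : m * c ^ 2 + g * c + h = 0) : c.re < 0 ∨ c.re = 0 ∧ g = 0 := by
  have hre : m * (c.re ^ 2 - c.im ^ 2) + g * c.re + h = 0 := by
    simpa [pow_two] using congrArg Complex.re hc
  have him : c.im * (2 * m * c.re + g) = 0 := by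
    have : m * (c.re * c.im + c.im * c.re) + g * c.im = 0 := by
      simpa [pow_two] using congrArg Complex.im hc
    linear_combination this
  rcases mul_eq_zero.1 him with h0 | h0
  · left
    rw [h0] at hre
    by_contra! hx
    have := mul_nonneg hg hx
    have : 0 ≤ m * c.re ^ 2 := by positivity
    linarith
  · rcases hg.eq_or_lt with rfl | hg
    · right
      exact ⟨by simpa [hm.ne'] using h0, rfl⟩
    · left
      nlinarith

lemma re_neg_of_quadratic_pencil {M H G : Matrix ι ι ℂ} (hM : M.PosDef) (hH : H.PosDef)
    (hG : G.PosSemidef) (hmode : HasNoUndampedMode M H G) {c : ℂ} {u : ι → ℂ} (hu : u ≠ 0)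
    (hc : c ^ 2 • M *ᵥ u + c • G *ᵥ u + H *ᵥ u = 0) : c.re < 0 := by
  obtain ⟨m, hm, hMu⟩ := RCLike.pos_iff_exists_ofReal.1 (hM.dotProduct_mulVec_pos hu)
  obtain ⟨h, hh, hHu⟩ := RCLike.pos_iff_exists_ofReal.1 (hH.dotProduct_mulVec_pos hu)
  obtain ⟨g, hg, hGu⟩ := RCLike.nonneg_iff_exists_ofReal.1 (hG.dotProduct_mulVec_nonneg u)
  have hquad : m * c ^ 2 + g * c + h = 0 := by
    have := congrArg (star u ⬝ᵥ ·) hc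
    simp only [dotProduct_add, dotProduct_smul, dotProduct_zero, smul_eq_mul, ← hMu, ← hHu,
      ← hGu] at this
    linear_combination this
  refine (re_neg_or_of_quadratic_eq_zero hm hg hh hquad).resolve_right ?_
  rintro ⟨hre, rfl⟩
  have hGu0 : G *ᵥ u = 0 := (hG.dotProduct_mulVec_zero_iff u).1 (by simp [← hGu])
  have hc2 : c ^ 2 = -((c.im ^ 2 : ℝ) : ℂ) := by
    apply Complex.ext <;> simp [pow_two, hre]
  refine hu (hmode (c.im ^ 2) u ?_ hGu0)
  rw [hGu0, hc2, smul_zero, add_zero, neg_smul, neg_add_eq_zero] at hc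
  rw [← hc, Complex.coe_smul]

theorem IsDampedOscillation.tendsto_zero_complex {M H G : Matrix ι ι ℂ}
    {z : ℝ → ι → ℂ} (hz : IsDampedOscillation M H G z) (hM : M.PosDef) (hH : H.PosDef)
    (hG : G.PosSemidef) (hmode : HasNoUndampedMode M H G) : Tendsto z atTop (𝓝 0) := by
  classical
  obtain ⟨w, a, h⟩ := hz
  have hMdet : IsUnit M.det := (isUnit_iff_isUnit_det M).1 hM.isUnit
  -- In phase space the pair `(z, w)` follows a first order linear equation.
  let A : (ι → ℂ) × (ι → ℂ) →ₗ[ℂ] (ι → ℂ) × (ι → ℂ) :=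
    (LinearMap.snd ℂ _ _).prod (M⁻¹.mulVecLin ∘ₗ (-H.mulVecLin).coprod (-G.mulVecLin))
  have hA (x y : ι → ℂ) : A (x, y) = (y, M⁻¹ *ᵥ (-(H *ᵥ x) - G *ᵥ y)) := by
    simp [A, sub_eq_add_neg]
  have key : Tendsto (fun t => (z t, w t)) atTop (𝓝 0) := by
    refine tendsto_zero_of_hasEigenvalue_re_neg (LinearMap.toContinuousLinearMap A)
      (fun c hc => ?_) _ (fun t ht => ?_)
    · obtain ⟨⟨x, y⟩, hxy⟩ := hc.exists_hasEigenvector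
      have hAxy : A (x, y) = c • (x, y) := hxy.apply_eq_smul
      obtain ⟨rfl, hacc⟩ : y = c • x ∧ M⁻¹ *ᵥ (-(H *ᵥ x) - G *ᵥ y) = c • y :=
        Prod.ext_iff.1 ((hA x y).symm.trans hAxy)
      have hx : x ≠ 0 := by
        rintro rfl
        exact hxy.2 (by simp)
      refine re_neg_of_quadratic_pencil hM hH hG hmode hx ?_
      have := congrArg (M *ᵥ ·) hacc
      simp only [mulVec_mulVec, mul_nonsing_inv M hMdet, one_mulVec, mulVec_smul] at this
      rw [pow_two, mul_smul, ← this]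
      abel
    · obtain ⟨hz, hw, heq⟩ := h t ht
      refine (hz.prodMk hw).congr_deriv ?_
      have hacc : -(H *ᵥ z t) - G *ᵥ w t = M *ᵥ a t := by
        linear_combination -heq
      simp [hA, hacc, mulVec_mulVec, nonsing_inv_mul M hMdet]
  exact (continuous_fst.tendsto _).comp key

theorem IsDampedOscillation.tendsto_zero {M H G : Matrix ι ι ℝ} {z : ℝ → ι → ℝ}
    (hz : IsDampedOscillation M H G z) (hM : M.PosDef) (hH : H.PosDef) (hG : G.PosSemidef)
    (hmode : HasNoUndampedMode M H G) : Tendsto z atTop (𝓝 0) := by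
  have h := hz.map_ofReal.tendsto_zero_complex (posDef_map_ofReal hM) (posDef_map_ofReal hH)
    (posSemidef_map_ofReal hG) hmode.map_ofReal
  rw [tendsto_pi_nhds] at h ⊢
  exact fun i => (Complex.continuous_re.tendsto 0).comp (h i)

theorem IsDampedOscillation.tendsto_mulVec_zero {M H G A C : Matrix ι ι ℝ}
    {z : ℝ → ι → ℝ} (hz : IsDampedOscillation M H G z) (hM : M.PosDef) (hH : H.PosDef)
    (hG : G.PosSemidef) (hA : A.PosSemidef) (hMC : Commute M C) (hHC : Commute H C)
    (hGC : Commute G C) (hAC : A * C = 0)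
    (hmode : ∀ (ν : ℝ) (u : ι → ℝ), H *ᵥ u = ν • M *ᵥ u → G *ᵥ u = 0 → A *ᵥ u = 0 → u = 0) :
    Tendsto (fun t => C *ᵥ z t) atTop (𝓝 0) := by
  -- `C z` does not feel the additional damping `A`.
  have hCz : IsDampedOscillation M H (G + A) fun t => C *ᵥ z t :=
    hz.mulVec hMC hHC (by rw [add_mul, hAC, add_zero, hGC.eq])
  exact hCz.tendsto_zero hM hH (hG.add hA) (hasNoUndampedMode_add hG hA hmode)

end DampedOscillator

/-! ### Synchronization of an array -/

section Synchronization

open scoped Kronecker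

variable {q n : ℕ}

lemma one_kronecker_mulVec {ι κ R : Type*} [Fintype ι] [Fintype κ] [DecidableEq ι] [CommSemiring R]
    (A : Matrix κ κ R) (x : ι × κ → R) (i : ι) (a : κ) :
    (((1 : Matrix ι ι R) ⊗ₖ A) *ᵥ x) (i, a) = (A *ᵥ fun b => x (i, b)) a := by
  simp [mulVec, dotProduct, Fintype.sum_prod_type, one_apply, ite_mul]

/-- The weights `W i j` of a matrix-weighted undirected graph. -/
structure IsCouplingWeight (W : Fin q → Fin q → Matrix (Fin n) (Fin n) ℝ) : Prop where
  posSemidef (i j : Fin q) : (W i j).PosSemidef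
  symm (i j : Fin q) : W i j = W j i
  diag (i : Fin q) : W i i = 0

/-- `x ↦ ∑ⱼ xⱼ`, the sum being repeated in each of the `q` blocks. -/
noncomputable def blockSum (q n : ℕ) : Matrix (Fin q × Fin n) (Fin q × Fin n) ℝ :=
  vecMulVec 1 1 ⊗ₖ 1

/-- `x ↦ (xᵢ - q⁻¹ ∑ⱼ xⱼ)ᵢ`, the deviation of the blocks from their mean. -/
noncomputable def disagreement (q n : ℕ) : Matrix (Fin q × Fin n) (Fin q × Fin n) ℝ :=
  1 - (q : ℝ)⁻¹ • blockSum q n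

lemma blockSum_mulVec (x : Fin q × Fin n → ℝ) (i : Fin q) (a : Fin n) :
    (blockSum q n *ᵥ x) (i, a) = ∑ j, x (j, a) := by
  simp [blockSum, mulVec, dotProduct, Fintype.sum_prod_type, one_apply, ite_mul]

lemma disagreement_mulVec_sub (x : Fin q × Fin n → ℝ) (i j : Fin q) (a : Fin n) :
    (disagreement q n *ᵥ x) (i, a) - (disagreement q n *ᵥ x) (j, a) = x (i, a) - x (j, a) := by
  simp [disagreement, sub_mulVec, smul_mulVec, blockSum_mulVec]

lemma blockSum_posSemidef : (blockSum q n).PosSemidef :=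
  PosSemidef.kronecker (by simpa using posSemidef_vecMulVec_self_star (1 : Fin q → ℝ)) .one

lemma blockSum_mul_disagreement [NeZero q] : blockSum q n * disagreement q n = 0 := by
  have hsq : blockSum q n * blockSum q n = (q : ℝ) • blockSum q n := by
    rw [blockSum, ← mul_kronecker_mul, vecMulVec_mul_vecMulVec, mul_one, vecMulVec_smul,
      smul_kronecker]
    simp
  rw [disagreement, mul_sub, mul_smul_comm, hsq, inv_smul_smul₀ (NeZero.ne (q : ℝ)), mul_one,
    sub_self]

lemma commute_one_kronecker_blockSum (A : Matrix (Fin n) (Fin n) ℝ) :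
    Commute ((1 : Matrix (Fin q) (Fin q) ℝ) ⊗ₖ A) (blockSum q n) := by
  simp [commute_iff_eq, blockSum, ← mul_kronecker_mul]

lemma commute_disagreement {X : Matrix (Fin q × Fin n) (Fin q × Fin n) ℝ}
    (h : Commute X (blockSum q n)) : Commute X (disagreement q n) :=
  (Commute.one_right X).sub_right (h.smul_right _)

lemma lap_mulVec {W : Fin q → Fin q → Matrix (Fin n) (Fin n) ℝ} (hW : ∀ i, W i i = 0)
    (x : Fin q × Fin n → ℝ) (i : Fin q) (a : Fin n) :
    (lap W *ᵥ x) (i, a) = (∑ j, W i j *ᵥ fun b => x (i, b) - x (j, b)) a := by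
  have hentry (j : Fin q) (b : Fin n) : lap W (i, a) (j, b) * x (j, b)
      = (if i = j then (∑ l, W i l a b) * x (i, b) else 0) - W i j a b * x (j, b) := by
    rcases eq_or_ne i j with rfl | hij
    · simp [lap, hW, Matrix.sum_apply]
    · simp [lap, hij]
  simp only [mulVec, dotProduct, Fintype.sum_prod_type, hentry, Finset.sum_sub_distrib,
    Finset.sum_apply, mul_sub, Finset.sum_mul]
  congr 1
  rw [Finset.sum_comm, Finset.sum_comm (s := Finset.univ (α := Fin q))]
  simp

lemma lap_mulVec_snd {W : Fin q → Fin q → Matrix (Fin n) (Fin n) ℝ} (hW : ∀ i, W i i = 0)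
    (c : Fin n → ℝ) : lap W *ᵥ (fun p => c p.2) = 0 := by
  ext ⟨i, a⟩
  simp [lap_mulVec hW, ← Pi.zero_def]

lemma lap_mul_blockSum {W : Fin q → Fin q → Matrix (Fin n) (Fin n) ℝ} (hW : ∀ i, W i i = 0) :
    lap W * blockSum q n = 0 := by
  ext p r
  have hconst : (blockSum q n).col r = fun p => (1 : Matrix (Fin n) (Fin n) ℝ) p.2 r.2 := by
    ext p
    simp [blockSum]
  change (lap W *ᵥ (blockSum q n).col r) p = 0
  rw [hconst, lap_mulVec_snd hW (fun a => (1 : Matrix (Fin n) (Fin n) ℝ) a r.2), Pi.zero_apply]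

lemma two_mul_dotProduct_lap_mulVec {W : Fin q → Fin q → Matrix (Fin n) (Fin n) ℝ}
    (hsymm : ∀ i j, W i j = W j i) (hdiag : ∀ i, W i i = 0) (x : Fin q × Fin n → ℝ) :
    2 * (x ⬝ᵥ lap W *ᵥ x) = ∑ i, ∑ j,
      (fun a => x (i, a) - x (j, a)) ⬝ᵥ W i j *ᵥ fun a => x (i, a) - x (j, a) := by
  set y : Fin q → Fin n → ℝ := fun i a => x (i, a)
  have hlap : x ⬝ᵥ lap W *ᵥ x = ∑ i, ∑ j, y i ⬝ᵥ W i j *ᵥ (y i - y j) := by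
    rw [dotProduct, Fintype.sum_prod_type]
    refine Finset.sum_congr rfl fun i _ => ?_
    rw [← dotProduct_sum, dotProduct]
    exact Finset.sum_congr rfl fun a _ => congrArg (y i a * ·) (lap_mulVec hdiag x i a)
  have hlap' : x ⬝ᵥ lap W *ᵥ x = ∑ i, ∑ j, -(y j ⬝ᵥ W i j *ᵥ (y i - y j)) := by
    rw [hlap, Finset.sum_comm]
    refine Finset.sum_congr rfl fun i _ => Finset.sum_congr rfl fun j _ => ?_
    rw [hsymm j i, ← neg_sub (y i), mulVec_neg, dotProduct_neg]
  rw [two_mul, congrArg₂ (· + ·) hlap hlap']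
  simp only [← Finset.sum_add_distrib, ← sub_eq_add_neg, ← sub_dotProduct]
  rfl

lemma IsCouplingWeight.smul {W : Fin q → Fin q → Matrix (Fin n) (Fin n) ℝ}
    (hW : IsCouplingWeight W) {c : ℝ} (hc : 0 ≤ c) :
    IsCouplingWeight fun i j => c • W i j where
  posSemidef i j := (hW.posSemidef i j).smul hc
  symm i j := by rw [hW.symm]
  diag i := by rw [hW.diag, smul_zero]

lemma IsCouplingWeight.isHermitian_lap {W : Fin q → Fin q → Matrix (Fin n) (Fin n) ℝ}
    (hW : IsCouplingWeight W) : (lap W).IsHermitian := by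
  ext ⟨i, a⟩ ⟨j, b⟩
  rw [conjTranspose_apply, star_trivial]
  rcases eq_or_ne i j with rfl | hij
  · have : (∑ l, W i l).IsHermitian := isSelfAdjoint_sum _ fun l _ => (hW.posSemidef i l).1
    simpa [lap] using this.apply a b
  · simpa [lap, hij, hij.symm, hW.symm j i] using (hW.posSemidef i j).1.apply a b

lemma IsCouplingWeight.posSemidef_lap {W : Fin q → Fin q → Matrix (Fin n) (Fin n) ℝ}
    (hW : IsCouplingWeight W) : (lap W).PosSemidef := by
  refine .of_dotProduct_mulVec_nonneg hW.isHermitian_lap fun x => ?_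
  have hsum := two_mul_dotProduct_lap_mulVec hW.symm hW.diag x
  have hnonneg : 0 ≤ ∑ i, ∑ j,
      (fun a => x (i, a) - x (j, a)) ⬝ᵥ W i j *ᵥ fun a => x (i, a) - x (j, a) :=
    Finset.sum_nonneg fun i _ => Finset.sum_nonneg fun j _ =>
      (hW.posSemidef i j).dotProduct_mulVec_nonneg _
  rw [star_trivial]
  linarith

lemma IsCouplingWeight.commute_lap_disagreement {W : Fin q → Fin q → Matrix (Fin n) (Fin n) ℝ}
    (hW : IsCouplingWeight W) : Commute (lap W) (disagreement q n) := by
  have hleft := lap_mul_blockSum hW.diag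
  have hright : blockSum q n * lap W = 0 := by
    rw [← blockSum_posSemidef.1.eq, ← hW.isHermitian_lap.eq, ← conjTranspose_mul, hleft,
      conjTranspose_zero]
  exact commute_disagreement (hleft.trans hright.symm)

lemma IsSolution.isDampedOscillation {M K : Matrix (Fin n) (Fin n) ℝ}
    {D R : Fin q → Fin q → Matrix (Fin n) (Fin n) ℝ} (hD : ∀ i, D i i = 0) (hR : ∀ i, R i i = 0)
    {x : Fin q → ℝ → EuclideanSpace ℝ (Fin n)} (hx : IsSolution M K D R x) :
    IsDampedOscillation ((1 : Matrix (Fin q) (Fin q) ℝ) ⊗ₖ M)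
      ((1 : Matrix (Fin q) (Fin q) ℝ) ⊗ₖ K + lap R) (lap D) fun t p => x p.1 t p.2 := by
  obtain ⟨v, a, h⟩ := hx
  have hcoord {y : ℝ → EuclideanSpace ℝ (Fin n)} {y' : EuclideanSpace ℝ (Fin n)} {t : ℝ}
      (hy : HasDerivWithinAt y y' (Set.Ici 0) t) (b : Fin n) :
      HasDerivWithinAt (fun t => y t b) (y' b) (Set.Ici 0) t :=
    (EuclideanSpace.proj (𝕜 := ℝ) b).hasFDerivAt.comp_hasDerivWithinAt t hy
  refine ⟨fun t p => v p.1 t p.2, fun t p => a p.1 t p.2, fun t ht =>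
    ⟨hasDerivWithinAt_pi.2 fun p => hcoord (h p.1 t ht).1 p.2,
      hasDerivWithinAt_pi.2 fun p => hcoord (h p.1 t ht).2.1 p.2, ?_⟩⟩
  ext ⟨i, b⟩
  have := congrFun (h i t ht).2.2 b
  simp only [Pi.add_apply, Pi.zero_apply, add_mulVec, one_kronecker_mulVec, lap_mulVec hD,
    lap_mulVec hR] at this ⊢
  rw [← this]
  simp only [Finset.sum_apply]
  ring!

theorem synchronizes_of_forall_undamped_mode {M K : Matrix (Fin n) (Fin n) ℝ}
    {D R : Fin q → Fin q → Matrix (Fin n) (Fin n) ℝ} (hM : M.PosDef) (hK : K.PosDef)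
    (hD : IsCouplingWeight D) (hR : IsCouplingWeight R)
    (hmode : ∀ (ν : ℝ) (u : Fin q × Fin n → ℝ),
      ((1 : Matrix (Fin q) (Fin q) ℝ) ⊗ₖ K + lap R) *ᵥ u
        = ν • ((1 : Matrix (Fin q) (Fin q) ℝ) ⊗ₖ M) *ᵥ u →
      lap D *ᵥ u = 0 → (∀ a, ∑ i, u (i, a) = 0) → u = 0) :
    Synchronizes M K D R := by
  intro x hx i j
  have : NeZero q := ⟨i.pos.ne'⟩
  have hlim := (hx.isDampedOscillation hD.diag hR.diag).tendsto_mulVec_zero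
    (PosDef.one.kronecker hM) ((PosDef.one.kronecker hK).add_posSemidef hR.posSemidef_lap)
    hD.posSemidef_lap blockSum_posSemidef
    (commute_disagreement (commute_one_kronecker_blockSum M))
    ((commute_disagreement (commute_one_kronecker_blockSum K)).add_left
      hR.commute_lap_disagreement)
    hD.commute_lap_disagreement blockSum_mul_disagreement fun ν u hu hDu hsum =>
      hmode ν u hu hDu fun a => by simpa [blockSum_mulVec] using congrFun hsum (i, a)
  rw [tendsto_pi_nhds] at hlim
  have hdiff : Tendsto (fun t => (x i t - x j t).ofLp) atTop (𝓝 0) :=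
    tendsto_pi_nhds.2 fun a => by
      simpa [disagreement_mulVec_sub] using (hlim (i, a)).sub (hlim (j, a))
  simpa using (((PiLp.continuous_toLp 2 _).tendsto 0).comp hdiff).norm

end Synchronization

/-! ### Perturbation of an operator with separated spectral blocks -/

section SpectralGap

variable {E F : Type*} [NormedAddCommGroup E] [InnerProductSpace ℝ E]
  [NormedAddCommGroup F] [InnerProductSpace ℝ F]

lemma exists_forall_ne_le_abs_sub {ι : Type*} [Finite ι] [Nonempty ι] {α : ι → ℝ} {d : ℝ}
    (hα : ∀ i j, α i ≠ α j → 2 * d ≤ |α i - α j|) (ν : ℝ) :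
    ∃ i, ∀ j, α j ≠ α i → d ≤ |α j - ν| := by
  obtain ⟨i, hi⟩ := Finite.exists_min fun i => |α i - ν|
  refine ⟨i, fun j hj => ?_⟩
  have htri : |α j - α i| ≤ |α j - ν| + |α i - ν| := abs_sub_comm (α i) ν ▸ abs_sub_le _ _ _
  linarith [hα j i hj, hi j]

lemma exists_mul_norm_sub_starProjection_eigenspace_le [FiniteDimensional ℝ E] {T : E →ₗ[ℝ] E}
    (hT : T.IsSymmetric) {d : ℝ} (hd : 0 ≤ d)
    (hgap : ∀ a ∈ spectrum ℝ T, ∀ b ∈ spectrum ℝ T, a ≠ b → 2 * d ≤ |a - b|) (ν : ℝ) (u : E) :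
    ∃ β, d * ‖u - (Module.End.eigenspace T β).starProjection u‖ ≤ ‖T u - ν • u‖ := by
  rcases subsingleton_or_nontrivial E with hE | hE
  · exact ⟨0, by simp [Subsingleton.elim _ (0 : E)]⟩
  have : Nonempty (Fin (Module.finrank ℝ E)) := ⟨⟨0, Module.finrank_pos⟩⟩
  set b := hT.eigenvectorBasis rfl
  set α := hT.eigenvalues rfl
  have hb (i) : T (b i) = α i • b i := hT.apply_eigenvectorBasis rfl i
  obtain ⟨i₀, hi₀⟩ := exists_forall_ne_le_abs_sub (α := α) (fun i j hij => hgap _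
    (hT.hasEigenvalue_eigenvalues rfl i).mem_spectrum _
    (hT.hasEigenvalue_eigenvalues rfl j).mem_spectrum hij) ν
  refine ⟨α i₀, le_of_sq_le_sq ?_ (norm_nonneg _)⟩
  rw [mul_pow, ← b.sum_sq_norm_inner_right, ← b.sum_sq_norm_inner_right, Finset.mul_sum]
  refine Finset.sum_le_sum fun i _ => ?_
  have hright : inner ℝ (b i) (T u - ν • u) = (α i - ν) * inner ℝ (b i) u := by
    rw [inner_sub_right, ← hT, hb, inner_smul_left, inner_smul_right, sub_mul]
    rfl
  rw [inner_sub_right, ← Submodule.inner_starProjection_left_eq_right, hright, norm_mul, mul_pow]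
  rcases eq_or_ne (α i) (α i₀) with hi | hi
  · have hmem : b i ∈ Module.End.eigenspace T (α i₀) :=
      Module.End.mem_eigenspace_iff.2 (hi ▸ hb i)
    rw [Submodule.starProjection_eq_self_iff.2 hmem, sub_self, norm_zero, zero_pow two_ne_zero,
      mul_zero]
    positivity
  · have hperp : b i ∈ (Module.End.eigenspace T (α i₀))ᗮ := fun x hx =>
      hT.orthogonalFamily_eigenspaces hi.symm ⟨x, hx⟩
        ⟨b i, Module.End.mem_eigenspace_iff.2 (hb i)⟩
    rw [(Submodule.starProjection_apply_eq_zero_iff _).2 hperp, inner_zero_left, sub_zero]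
    gcongr
    exact hi₀ i hi

lemma inner_starProjection_eigenspace_eq_zero [FiniteDimensional ℝ E] {T : E →ₗ[ℝ] E}
    (hT : T.IsSymmetric) {e y : E} {μ : ℝ} (he : T e = μ • e) (hy : inner ℝ e y = 0) (β : ℝ) :
    inner ℝ e ((Module.End.eigenspace T β).starProjection y) = 0 := by
  rw [← Submodule.inner_starProjection_left_eq_right]
  rcases eq_or_ne μ β with rfl | hμ
  · rwa [Submodule.starProjection_eq_self_iff.2 (Module.End.mem_eigenspace_iff.2 he)]
  · have hperp : e ∈ (Module.End.eigenspace T β)ᗮ := fun x hx =>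
      hT.orthogonalFamily_eigenspaces hμ.symm ⟨x, hx⟩ ⟨e, Module.End.mem_eigenspace_iff.2 he⟩
    rw [(Submodule.starProjection_apply_eq_zero_iff _).2 hperp, inner_zero_left]

/-- Here `J` embeds `F` into `E` as the eigenspace of `A` to the eigenvalue `σ` and `S` retracts
`E` onto it, so that `T = S B J` is the diagonal block of `B` at this eigenspace. -/
theorem exists_norm_sub_starProjection_eigenspace_le [FiniteDimensional ℝ F] {A B : E →L[ℝ] E}
    {S : E →ₗ[ℝ] F} {J : F →ₗᵢ[ℝ] E} {T : F →ₗ[ℝ] F} (hS : ∀ x, ‖S x‖ ≤ ‖x‖)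
    (hTSJ : ∀ y, T y = S (B (J y))) (hT : T.IsSymmetric) {σ ν ε s m : ℝ}
    (hSA : ∀ x, S (A x) = σ • S x) (hs : 0 < s) (hm : 0 < m) (hε : 0 < ε)
    (hgap : ∀ a ∈ spectrum ℝ T, ∀ b ∈ spectrum ℝ T, a ≠ b → 2 * m ≤ |a - b|) {u : E}
    (hu : A u + ε • B u = ν • u) (hnear : s * ‖u - J (S u)‖ ≤ ‖A u - ν • u‖) :
    ∃ β, ‖u - J ((Module.End.eigenspace T β).starProjection (S u))‖
      ≤ ε * ‖B‖ * (m + ‖B‖) / (s * m) * ‖u‖ := by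
  obtain ⟨β, hβ⟩ :=
    exists_mul_norm_sub_starProjection_eigenspace_le hT hm.le hgap ((ν - σ) / ε) (S u)
  refine ⟨β, ?_⟩
  set w := (Module.End.eigenspace T β).starProjection (S u)
  have hblock : ‖u - J (S u)‖ ≤ ε * ‖B‖ / s * ‖u‖ := by
    rw [div_mul_eq_mul_div, le_div_iff₀' hs]
    refine hnear.trans ?_
    rw [← hu, sub_add_cancel_left, norm_neg, norm_smul, Real.norm_of_nonneg hε.le, mul_assoc]
    gcongr
    exact B.le_opNorm u
  -- Applying `S` to the eigenvalue equation shows that `S u` is nearly an eigenvector of `T`.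
  have hresidual : T (S u) - ((ν - σ) / ε) • S u = -S (B (u - J (S u))) := by
    have hSu : σ • S u + ε • S (B u) = ν • S u := by
      simpa only [map_add, map_smul, hSA] using congrArg S hu
    have hSBu : S (B u) = ((ν - σ) / ε) • S u := by
      rw [div_eq_inv_mul, mul_smul, sub_smul, ← hSu, add_sub_cancel_left,
        inv_smul_smul₀ hε.ne']
    rw [map_sub, map_sub, ← hTSJ, hSBu, neg_sub]
  have heigen : ‖S u - w‖ ≤ ‖B‖ * (ε * ‖B‖ / s * ‖u‖) / m := by
    rw [le_div_iff₀' hm]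
    calc m * ‖S u - w‖ ≤ ‖S (B (u - J (S u)))‖ := by rwa [hresidual, norm_neg] at hβ
      _ ≤ ‖B‖ * ‖u - J (S u)‖ := (hS _).trans (B.le_opNorm _)
      _ ≤ _ := by gcongr
  calc ‖u - J w‖ = ‖(u - J (S u)) + J (S u - w)‖ := by rw [map_sub, sub_add_sub_cancel]
    _ ≤ ‖u - J (S u)‖ + ‖S u - w‖ := (norm_add_le _ _).trans_eq (by rw [J.norm_map])
    _ ≤ ε * ‖B‖ / s * ‖u‖ + ‖B‖ * (ε * ‖B‖ / s * ‖u‖) / m := add_le_add hblock heigen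
    _ = _ := by field_simp

end SpectralGap

/-! ### Block matrices -/

section BlockMatrix

variable {κ ι : Type*}

/-- The `k`-th diagonal block of a block matrix. -/
abbrev diagBlock (X : Matrix (κ × ι) (κ × ι) ℝ) (k : κ) : Matrix ι ι ℝ :=
  X.submatrix (Prod.mk k) (Prod.mk k)

/-- The `k`-th block of a vector. -/
def blockProj (k : κ) : EuclideanSpace ℝ (κ × ι) →ₗ[ℝ] EuclideanSpace ℝ ι where
  toFun u := WithLp.toLp 2 fun i => u (k, i)
  map_add' _ _ := rfl
  map_smul' _ _ := rfl

lemma blockProj_apply (k : κ) (u : EuclideanSpace ℝ (κ × ι)) (i : ι) :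
    blockProj k u i = u (k, i) := rfl

variable [Fintype κ] [Fintype ι]

lemma norm_sq_eq_sum_norm_blockProj_sq (u : EuclideanSpace ℝ (κ × ι)) :
    ‖u‖ ^ 2 = ∑ k, ‖blockProj k u‖ ^ 2 := by
  simp only [EuclideanSpace.norm_sq_eq, Fintype.sum_prod_type, blockProj_apply]

lemma norm_blockProj_le (k : κ) (u : EuclideanSpace ℝ (κ × ι)) : ‖blockProj k u‖ ≤ ‖u‖ := by
  refine le_of_sq_le_sq ?_ (norm_nonneg u)
  rw [norm_sq_eq_sum_norm_blockProj_sq u]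
  exact Finset.single_le_sum (f := fun k => ‖blockProj k u‖ ^ 2) (fun _ _ => sq_nonneg _)
    (Finset.mem_univ k)

variable [DecidableEq κ]

/-- The embedding of the `k`-th block; all other blocks are `0`. -/
def blockEmbed (k : κ) : EuclideanSpace ℝ ι →ₗᵢ[ℝ] EuclideanSpace ℝ (κ × ι) where
  toFun w := WithLp.toLp 2 fun p => if p.1 = k then w p.2 else 0
  map_add' w w' := by ext p; simp [ite_add_zero]
  map_smul' c w := by ext p; simp
  norm_map' w := by simp [EuclideanSpace.norm_eq, Fintype.sum_prod_type, apply_ite]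

lemma blockEmbed_apply (k : κ) (w : EuclideanSpace ℝ ι) (p : κ × ι) :
    blockEmbed k w p = if p.1 = k then w p.2 else 0 := rfl

lemma blockProj_blockEmbed (k l : κ) (w : EuclideanSpace ℝ ι) :
    blockProj l (blockEmbed k w) = if l = k then w else 0 := by
  ext i
  rw [blockProj_apply, blockEmbed_apply]
  split_ifs <;> rfl

lemma inner_blockEmbed_left (k : κ) (w : EuclideanSpace ℝ ι) (u : EuclideanSpace ℝ (κ × ι)) :
    inner ℝ (blockEmbed k w) u = inner ℝ w (blockProj k u) := by
  simp [PiLp.inner_apply, Fintype.sum_prod_type, blockEmbed_apply, blockProj_apply]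

variable [DecidableEq ι]

lemma blockProj_toEuclideanCLM_blockEmbed (X : Matrix (κ × ι) (κ × ι) ℝ) (k : κ)
    (w : EuclideanSpace ℝ ι) :
    blockProj k (toEuclideanCLM (𝕜 := ℝ) X (blockEmbed k w))
      = toEuclideanLin (diagBlock X k) w := by
  ext i
  simp [blockProj_apply, mulVec, dotProduct, Fintype.sum_prod_type, blockEmbed_apply]

lemma blockProj_toEuclideanCLM_diagonal (σ : κ → ℝ) (k : κ) (u : EuclideanSpace ℝ (κ × ι)) :
    blockProj k (toEuclideanCLM (𝕜 := ℝ) (diagonal fun p => σ p.1) u) = σ k • blockProj k u := by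
  ext i
  simp [blockProj_apply, mulVec_diagonal]

lemma exists_mul_norm_sub_blockEmbed_le [Nonempty κ] {σ : κ → ℝ} {s : ℝ} (hs : 0 ≤ s)
    (hσ : ∀ k l, k ≠ l → 2 * s ≤ |σ k - σ l|) (ν : ℝ) (u : EuclideanSpace ℝ (κ × ι)) :
    ∃ k, s * ‖u - blockEmbed k (blockProj k u)‖
      ≤ ‖toEuclideanCLM (𝕜 := ℝ) (diagonal fun p => σ p.1) u - ν • u‖ := by
  obtain ⟨k, hk⟩ :=
    exists_forall_ne_le_abs_sub (fun k l hkl => hσ k l (ne_of_apply_ne σ hkl)) ν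
  refine ⟨k, le_of_sq_le_sq ?_ (norm_nonneg _)⟩
  rw [mul_pow, norm_sq_eq_sum_norm_blockProj_sq, norm_sq_eq_sum_norm_blockProj_sq, Finset.mul_sum]
  refine Finset.sum_le_sum fun l _ => ?_
  rw [map_sub, map_sub, map_smul, blockProj_toEuclideanCLM_diagonal, ← sub_smul, norm_smul,
    mul_pow, blockProj_blockEmbed]
  split_ifs with hl
  · subst hl
    rw [sub_self, norm_zero, zero_pow two_ne_zero, mul_zero]
    positivity
  · rw [sub_zero]
    gcongr
    rcases eq_or_ne (σ l) (σ k) with h | h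
    · have hs' := hσ l k hl
      rw [h, sub_self, abs_zero] at hs'
      exact le_trans (by linarith) (norm_nonneg _)
    · exact hk l h

lemma exists_norm_sub_blockEmbed_eigenvector_le {σ : κ → ℝ} {B : Matrix (κ × ι) (κ × ι) ℝ}
    (hB : B.IsHermitian) {s m ε ν : ℝ} (hs : 0 < s) (hm : 0 < m) (hε : 0 < ε)
    (hσ : ∀ k l, k ≠ l → 2 * s ≤ |σ k - σ l|)
    (hgap : ∀ k, ∀ a ∈ spectrum ℝ (diagBlock B k), ∀ b ∈ spectrum ℝ (diagBlock B k), a ≠ b →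
      2 * m ≤ |a - b|)
    {e : EuclideanSpace ℝ ι} (hBe : ∀ k, diagBlock B k *ᵥ e.ofLp = 0)
    [Nonempty κ] {u : EuclideanSpace ℝ (κ × ι)} (hue : ∀ k, inner ℝ e (blockProj k u) = 0)
    (hu : (diagonal (fun p => σ p.1) + ε • B) *ᵥ u.ofLp = ν • u.ofLp) :
    ∃ (k : κ) (w : EuclideanSpace ℝ ι) (β : ℝ),
      diagBlock B k *ᵥ w.ofLp = β • w.ofLp ∧ inner ℝ e w = 0 ∧
      ‖u - blockEmbed k w‖ ≤ ε * norm2 B * (m + norm2 B) / (s * m) * ‖u‖ := by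
  obtain ⟨k, hk⟩ := exists_mul_norm_sub_blockEmbed_le hs.le hσ ν u
  have hT : (toEuclideanLin (𝕜 := ℝ) (diagBlock B k)).IsSymmetric :=
    isSymmetric_toEuclideanLin_iff.2 (hB.submatrix _)
  obtain ⟨β, hβ⟩ := exists_norm_sub_starProjection_eigenspace_le (norm_blockProj_le k)
    (fun w => (blockProj_toEuclideanCLM_blockEmbed B k w).symm) hT
    (blockProj_toEuclideanCLM_diagonal σ k) hs hm hε (by simpa only [spectrum_toLpLin] using hgap k)
    (u := u) (by ext p; simpa [add_mulVec, smul_mulVec] using congrFun hu p) hk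
  refine ⟨k, _, β, ?_, ?_, hβ⟩
  · have hw := Module.End.mem_eigenspace_iff.1 (Submodule.starProjection_apply_mem
      (Module.End.eigenspace (toEuclideanLin (𝕜 := ℝ) (diagBlock B k)) β) (blockProj k u))
    simpa using congrArg WithLp.ofLp hw
  · refine inner_starProjection_eigenspace_eq_zero hT (μ := 0) ?_ (hue k) β
    ext i
    simpa using congrFun (hBe k) i

lemma norm2_nonneg (X : Matrix ι ι ℝ) : 0 ≤ norm2 X :=
  norm_nonneg _

lemma norm2_pos {X : Matrix ι ι ℝ} (hX : X ≠ 0) : 0 < norm2 X :=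
  norm_pos_iff.2 fun h => hX (toEuclideanCLM.injective (h.trans (map_zero _).symm))

lemma dotProduct_mulVec_le_norm2 (X : Matrix ι ι ℝ) (x : EuclideanSpace ℝ ι) :
    x.ofLp ⬝ᵥ X *ᵥ x.ofLp ≤ norm2 X * ‖x‖ ^ 2 := by
  rw [← inner_toEuclideanCLM]
  calc _ ≤ ‖x‖ * ‖toEuclideanCLM (𝕜 := ℝ) X x‖ := real_inner_le_norm _ _
    _ ≤ ‖x‖ * (norm2 X * ‖x‖) := by gcongr; exact ContinuousLinearMap.le_opNorm _ x
    _ = _ := by ring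

lemma dotProduct_diagBlock_mulVec_le {G : Matrix (κ × ι) (κ × ι) ℝ} (hG : G.IsHermitian)
    {u : EuclideanSpace ℝ (κ × ι)} (hGu : G *ᵥ u.ofLp = 0) (k : κ) (w : EuclideanSpace ℝ ι) :
    w.ofLp ⬝ᵥ diagBlock G k *ᵥ w.ofLp ≤ norm2 G * ‖u - blockEmbed k w‖ ^ 2 := by
  have hsymm := isSymmetric_toEuclideanLin_iff.2 hG
  set A := toEuclideanCLM (𝕜 := ℝ) G with hA
  have hAu : A u = 0 := by
    ext p
    simpa [hA] using congrFun hGu p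
  have hblock : w.ofLp ⬝ᵥ diagBlock G k *ᵥ w.ofLp
      = inner ℝ (blockEmbed k w) (A (blockEmbed k w)) := by
    rw [inner_blockEmbed_left, blockProj_toEuclideanCLM_blockEmbed, ← inner_toEuclideanCLM]
    rfl
  have hshift : inner ℝ (u - blockEmbed k w) (A (u - blockEmbed k w))
      = inner ℝ (blockEmbed k w) (A (blockEmbed k w)) := by
    have hcross : inner ℝ u (A (blockEmbed k w)) = 0 := by
      rw [← inner_zero_left (blockEmbed k w), ← hAu]
      exact (hsymm u (blockEmbed k w)).symm
    rw [map_sub, hAu, zero_sub, inner_neg_right, inner_sub_left, hcross, zero_sub, neg_neg]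
  rw [hblock, ← hshift, hA, inner_toEuclideanCLM]
  exact dotProduct_mulVec_le_norm2 G _

theorem eq_zero_of_undamped_mode {σ : κ → ℝ} {G B : Matrix (κ × ι) (κ × ι) ℝ}
    (hG : G.IsHermitian) (hB : B.IsHermitian) {s m γ ε ν : ℝ} (hs : 0 < s) (hm : 0 < m)
    (hγ : 0 < γ) (hε : 0 < ε) (hσ : ∀ k l, k ≠ l → 2 * s ≤ |σ k - σ l|)
    (hgap : ∀ k, ∀ a ∈ spectrum ℝ (diagBlock B k), ∀ b ∈ spectrum ℝ (diagBlock B k), a ≠ b →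
      2 * m ≤ |a - b|)
    (hB1 : ∀ k, diagBlock B k *ᵥ 1 = 0)
    (hγG : ∀ (k : κ) (w : EuclideanSpace ℝ ι) (β : ℝ),
      diagBlock B k *ᵥ w.ofLp = β • w.ofLp → ∑ i, w i = 0 →
      γ ^ 2 * ‖w‖ ^ 2 ≤ w.ofLp ⬝ᵥ diagBlock G k *ᵥ w.ofLp)
    (hsmall : ε * norm2 B * (m + norm2 B) * (√(norm2 G) + γ) < γ * s * m)
    {u : κ × ι → ℝ} (hu : (diagonal (fun p => σ p.1) + ε • B) *ᵥ u = ν • u)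
    (hGu : G *ᵥ u = 0) (hu1 : ∀ k, ∑ i, u (k, i) = 0) : u = 0 := by
  rcases isEmpty_or_nonempty κ with hκ | hκ
  · exact Subsingleton.elim _ _
  have hsum (w : EuclideanSpace ℝ ι) : inner ℝ (WithLp.toLp 2 1) w = ∑ i, w i := by
    simp [PiLp.inner_apply]
  obtain ⟨k, w, β, hw, hw1, hle⟩ := exists_norm_sub_blockEmbed_eigenvector_le hB hs hm hε hσ hgap
    (e := WithLp.toLp 2 1) hB1 (u := WithLp.toLp 2 u) (fun k => (hsum _).trans (hu1 k)) hu
  set U : EuclideanSpace ℝ (κ × ι) := WithLp.toLp 2 u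
  set δ := ε * norm2 B * (m + norm2 B) / (s * m) with hδ
  have hγw : γ * ‖w‖ ≤ √(norm2 G) * ‖U - blockEmbed k w‖ := by
    refine le_of_sq_le_sq ?_ (by positivity)
    rw [mul_pow, mul_pow, Real.sq_sqrt (norm2_nonneg G)]
    exact (hγG k w β hw (hsum w ▸ hw1)).trans (dotProduct_diagBlock_mulVec_le hG hGu k w)
  have hU_le : ‖U‖ ≤ ‖U - blockEmbed k w‖ + ‖w‖ := by
    simpa using norm_add_le (U - blockEmbed k w) (blockEmbed k w)
  have hδγ : δ * (√(norm2 G) + γ) < γ := by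
    rw [hδ, div_mul_eq_mul_div, div_lt_iff₀ (mul_pos hs hm), ← mul_assoc]
    exact hsmall
  have hγU : γ * ‖U‖ ≤ δ * (√(norm2 G) + γ) * ‖U‖ :=
    calc γ * ‖U‖ ≤ γ * ‖U - blockEmbed k w‖ + γ * ‖w‖ := by rw [← mul_add]; gcongr
      _ ≤ (√(norm2 G) + γ) * ‖U - blockEmbed k w‖ := by linarith
      _ ≤ (√(norm2 G) + γ) * (δ * ‖U‖) := by gcongr
      _ = δ * (√(norm2 G) + γ) * ‖U‖ := by ring
  have hU0 : U = 0 := by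
    by_contra h
    exact hγU.not_gt (mul_lt_mul_of_pos_right hδγ (norm_pos_iff.2 h))
  exact congrArg WithLp.ofLp hU0

end BlockMatrix

/-! ### Modal coordinates -/

section ModalCoordinates

open scoped Kronecker MatrixOrder

variable {q n : ℕ}

lemma isUnit_det_sqrt {M : Matrix (Fin n) (Fin n) ℝ} (hM : M.PosDef) :
    IsUnit (CFC.sqrt M).det := by
  have hdet : (CFC.sqrt M).det * (CFC.sqrt M).det = M.det := by
    rw [← det_mul, CFC.sqrt_mul_sqrt_self M hM.posSemidef.nonneg]
  exact isUnit_of_mul_isUnit_left (hdet ▸ hM.det_pos.ne'.isUnit)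

lemma isHermitian_invSqrt (M : Matrix (Fin n) (Fin n) ℝ) : (invSqrt M).IsHermitian :=
  (nonneg_iff_posSemidef.1 (CFC.sqrt_nonneg M)).1.inv

lemma invSqrt_mul_mul_invSqrt {M : Matrix (Fin n) (Fin n) ℝ} (hM : M.PosDef) :
    invSqrt M * M * invSqrt M = 1 := by
  have hsq := CFC.sqrt_mul_sqrt_self M hM.posSemidef.nonneg
  nth_rw 2 [← hsq]
  rw [invSqrt, nonsing_inv_mul_cancel_left _ _ (isUnit_det_sqrt hM),
    mul_nonsing_inv _ (isUnit_det_sqrt hM)]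

lemma isHermitian_normalizedStiffness (M : Matrix (Fin n) (Fin n) ℝ)
    {K : Matrix (Fin n) (Fin n) ℝ} (hK : K.IsHermitian) :
    (normalizedStiffness M K).IsHermitian := by
  simpa only [normalizedStiffness, (isHermitian_invSqrt M).eq] using
    isHermitian_conjTranspose_mul_mul (invSqrt M) hK

/-- The matrix with the columns `v₁, …, v_n`. -/
def modeMatrix (v : Fin n → EuclideanSpace ℝ (Fin n)) : Matrix (Fin n) (Fin n) ℝ :=
  Matrix.of fun a k => v k a

lemma modeMatrix_orthogonal {P : Matrix (Fin n) (Fin n) ℝ} (hP : P.IsHermitian)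
    {σ : Fin n → ℝ} {v : Fin n → EuclideanSpace ℝ (Fin n)} (hσ : Function.Injective σ)
    (hv : ∀ k, ‖v k‖ = 1) (hPv : ∀ k, P *ᵥ (v k).ofLp = σ k • (v k).ofLp) :
    (modeMatrix v)ᵀ * modeMatrix v = 1 := by
  have hev (k : Fin n) : v k ∈ Module.End.eigenspace (toEuclideanLin P) (σ k) :=
    Module.End.mem_eigenspace_iff.2 (congrArg (WithLp.toLp 2) (hPv k))
  have horth : Orthonormal ℝ v := ⟨hv, fun k l hkl =>
    (isSymmetric_toEuclideanLin_iff.2 hP).orthogonalFamily_eigenspaces (hσ.ne hkl)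
      ⟨v k, hev k⟩ ⟨v l, hev l⟩⟩
  ext k l
  have := orthonormal_iff_ite.1 horth l k
  rw [EuclideanSpace.inner_eq_star_dotProduct, star_trivial] at this
  rw [one_apply, ← ite_congr (propext eq_comm) (fun _ => rfl) (fun _ => rfl)]
  exact this

lemma mul_modeMatrix {P : Matrix (Fin n) (Fin n) ℝ} {σ : Fin n → ℝ}
    {v : Fin n → EuclideanSpace ℝ (Fin n)}
    (hPv : ∀ k, P *ᵥ (v k).ofLp = σ k • (v k).ofLp) :
    P * modeMatrix v = modeMatrix v * diagonal σ := by
  ext a k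
  rw [mul_diagonal]
  exact (congrFun (hPv k) a).trans (mul_comm _ _)

/-- The matrix `I_q ⊗ U`, its columns being indexed by (mode, oscillator) instead of
(oscillator, mode), as for `modalMatrix`. -/
def modalStack (q : ℕ) (U : Matrix (Fin n) (Fin n) ℝ) :
    Matrix (Fin q × Fin n) (Fin n × Fin q) ℝ :=
  ((1 : Matrix (Fin q) (Fin q) ℝ) ⊗ₖ U).submatrix id Prod.swap

lemma one_kronecker_mul_modalStack (X U : Matrix (Fin n) (Fin n) ℝ) :
    ((1 : Matrix (Fin q) (Fin q) ℝ) ⊗ₖ X) * modalStack q U = modalStack q (X * U) := by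
  conv_rhs => rw [modalStack, ← one_mul (1 : Matrix (Fin q) (Fin q) ℝ), mul_kronecker_mul]
  rfl

lemma modalStack_mul_transpose (U Y : Matrix (Fin n) (Fin n) ℝ) :
    modalStack q U * (modalStack q Y)ᵀ = (1 : Matrix (Fin q) (Fin q) ℝ) ⊗ₖ (U * Yᵀ) := by
  rw [modalStack, modalStack, transpose_submatrix, ← submatrix_mul _ _ _ _ _ Prod.swap_bijective,
    ← kroneckerMap_transpose, transpose_one, ← mul_kronecker_mul, one_mul, submatrix_id_id]

lemma transpose_modalStack_mul (U Y : Matrix (Fin n) (Fin n) ℝ) :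
    (modalStack q U)ᵀ * modalStack q Y
      = ((1 : Matrix (Fin q) (Fin q) ℝ) ⊗ₖ (Uᵀ * Y)).submatrix Prod.swap Prod.swap := by
  rw [modalStack, modalStack, transpose_submatrix, ← submatrix_mul _ _ _ _ _ Function.bijective_id,
    ← kroneckerMap_transpose, transpose_one, ← mul_kronecker_mul, one_mul]

lemma transpose_modalStack_mul_one_kronecker_mul {U X : Matrix (Fin n) (Fin n) ℝ} {d : Fin n → ℝ}
    (h : Uᵀ * X * U = diagonal d) :
    (modalStack q U)ᵀ * ((1 : Matrix (Fin q) (Fin q) ℝ) ⊗ₖ X) * modalStack q U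
      = diagonal fun p => d p.1 := by
  rw [Matrix.mul_assoc, one_kronecker_mul_modalStack, transpose_modalStack_mul, ← mul_assoc, h,
    one_kronecker, blockDiagonal_diagonal]
  ext p r
  simp [diagonal_apply, Prod.ext_iff, and_comm]

lemma sum_transpose_modalStack_mulVec {u : Fin q × Fin n → ℝ} (hu : ∀ a, ∑ i, u (i, a) = 0)
    (Y : Matrix (Fin n) (Fin n) ℝ) (k : Fin n) :
    ∑ i, ((modalStack q Y)ᵀ *ᵥ u) (k, i) = 0 := by
  simp only [modalStack, mulVec, dotProduct, transpose_apply, submatrix_apply, Prod.swap,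
    Fintype.sum_prod_type, kronecker_apply, one_apply, ite_mul, one_mul, zero_mul, id]
  rw [Finset.sum_comm]
  simp [← Finset.sum_comm (γ := Fin n), ← Finset.mul_sum, hu, Finset.sum_ite_eq]

lemma modalMatrix_eq (L : Matrix (Fin q × Fin n) (Fin q × Fin n) ℝ)
    (v : Fin n → EuclideanSpace ℝ (Fin n)) :
    modalMatrix L v = (modalStack q (modeMatrix v))ᵀ * L * modalStack q (modeMatrix v) := rfl

lemma IsCouplingWeight.invSqrt_mul_mul_invSqrt {W : Fin q → Fin q → Matrix (Fin n) (Fin n) ℝ}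
    (hW : IsCouplingWeight W) (M : Matrix (Fin n) (Fin n) ℝ) :
    IsCouplingWeight fun i j => invSqrt M * W i j * invSqrt M where
  posSemidef i j := by
    simpa only [(isHermitian_invSqrt M).eq] using
      (hW.posSemidef i j).conjTranspose_mul_mul_same (invSqrt M)
  symm i j := by rw [hW.symm]
  diag i := by rw [hW.diag, mul_zero, zero_mul]

lemma IsCouplingWeight.posSemidef_modalMatrix_couplingLap
    {W : Fin q → Fin q → Matrix (Fin n) (Fin n) ℝ} (hW : IsCouplingWeight W)
    (M : Matrix (Fin n) (Fin n) ℝ) (v : Fin n → EuclideanSpace ℝ (Fin n)) :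
    (modalMatrix (couplingLap M W) v).PosSemidef :=
  (hW.invSqrt_mul_mul_invSqrt M).posSemidef_lap.conjTranspose_mul_mul_same
    (modalStack q (modeMatrix v))

lemma IsCouplingWeight.posSemidef_modalBlock_couplingLap
    {W : Fin q → Fin q → Matrix (Fin n) (Fin n) ℝ} (hW : IsCouplingWeight W)
    (M : Matrix (Fin n) (Fin n) ℝ) (v : Fin n → EuclideanSpace ℝ (Fin n)) (k : Fin n) :
    (modalBlock (couplingLap M W) v k k).PosSemidef :=
  (hW.posSemidef_modalMatrix_couplingLap M v).submatrix (Prod.mk k)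

lemma modalBlock_lap_mulVec_one {W : Fin q → Fin q → Matrix (Fin n) (Fin n) ℝ}
    (hW : ∀ i, W i i = 0) (v : Fin n → EuclideanSpace ℝ (Fin n)) (k l : Fin n) :
    modalBlock (lap W) v k l *ᵥ 1 = 0 := by
  have hone : idKron q (v l) *ᵥ 1 = fun p => v l p.2 := by
    ext p
    simp [idKron, mulVec, dotProduct, one_apply, ite_mul]
  rw [modalBlock, ← mulVec_mulVec, ← mulVec_mulVec, hone, lap_mulVec_snd hW, mulVec_zero]

lemma IsCouplingWeight.modalBlock_couplingLap_mulVec_one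
    {W : Fin q → Fin q → Matrix (Fin n) (Fin n) ℝ} (hW : IsCouplingWeight W)
    (M : Matrix (Fin n) (Fin n) ℝ) (v : Fin n → EuclideanSpace ℝ (Fin n)) (k l : Fin n) :
    modalBlock (couplingLap M W) v k l *ᵥ 1 = 0 :=
  modalBlock_lap_mulVec_one (hW.invSqrt_mul_mul_invSqrt M).diag v k l

lemma lap_submatrix (W : Fin q → Fin q → Matrix (Fin n) (Fin n) ℝ) (i j : Fin q) :
    (lap W).submatrix (Prod.mk i) (Prod.mk j) = if i = j then ∑ l, W i l else -W i j := by
  ext a b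
  split_ifs with h <;> simp [lap, h]

lemma one_kronecker_mul_mul_apply (X Y : Matrix (Fin n) (Fin n) ℝ)
    (L : Matrix (Fin q × Fin n) (Fin q × Fin n) ℝ) (i j : Fin q) (a b : Fin n) :
    (((1 : Matrix (Fin q) (Fin q) ℝ) ⊗ₖ X) * L * ((1 : Matrix (Fin q) (Fin q) ℝ) ⊗ₖ Y))
      (i, a) (j, b) = (X * L.submatrix (Prod.mk i) (Prod.mk j) * Y) a b := by
  simp [mul_apply, Fintype.sum_prod_type, one_apply, ite_mul]

lemma lap_mul_mul (X Y : Matrix (Fin n) (Fin n) ℝ) (W : Fin q → Fin q → Matrix (Fin n) (Fin n) ℝ) :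
    lap (fun i j => X * W i j * Y)
      = ((1 : Matrix (Fin q) (Fin q) ℝ) ⊗ₖ X) * lap W * ((1 : Matrix (Fin q) (Fin q) ℝ) ⊗ₖ Y) := by
  ext ⟨i, a⟩ ⟨j, b⟩
  rw [one_kronecker_mul_mul_apply]
  rw [lap_submatrix]
  change (lap fun i j => X * W i j * Y).submatrix (Prod.mk i) (Prod.mk j) a b = _
  rw [lap_submatrix]
  split_ifs
  · rw [Matrix.mul_sum, Matrix.sum_mul]
  · rw [mul_neg, neg_mul]

lemma modalMatrix_couplingLap (M : Matrix (Fin n) (Fin n) ℝ)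
    (W : Fin q → Fin q → Matrix (Fin n) (Fin n) ℝ) (v : Fin n → EuclideanSpace ℝ (Fin n)) :
    modalMatrix (couplingLap M W) v = (modalStack q (invSqrt M * modeMatrix v))ᵀ * lap W
      * modalStack q (invSqrt M * modeMatrix v) := by
  rw [modalMatrix_eq, couplingLap, lap_mul_mul, ← one_kronecker_mul_modalStack, transpose_mul,
    ← kroneckerMap_transpose, transpose_one, ← conjTranspose_eq_transpose_of_trivial (invSqrt M),
    (isHermitian_invSqrt M).eq]
  simp only [Matrix.mul_assoc]

/-- The columns of `U` are undamped modes of `M ẍ + K x = 0` with squared frequencies `σ`,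
normalized to be `M`-orthonormal. -/
structure IsModalBasis (M K U : Matrix (Fin n) (Fin n) ℝ) (σ : Fin n → ℝ) : Prop where
  mass : Uᵀ * M * U = 1
  stiffness : Uᵀ * K * U = diagonal σ

lemma isModalBasis_invSqrt_mul_modeMatrix {M K : Matrix (Fin n) (Fin n) ℝ} (hM : M.PosDef)
    (hK : K.IsHermitian) {σ : Fin n → ℝ} {v : Fin n → EuclideanSpace ℝ (Fin n)}
    (hσ : Function.Injective σ) (hv : ∀ k, ‖v k‖ = 1)
    (hPv : ∀ k, normalizedStiffness M K *ᵥ (v k).ofLp = σ k • (v k).ofLp) :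
    IsModalBasis M K (invSqrt M * modeMatrix v) σ := by
  have hV := modeMatrix_orthogonal (isHermitian_normalizedStiffness M hK) hσ hv hPv
  have hcongr (X : Matrix (Fin n) (Fin n) ℝ) :
      (invSqrt M * modeMatrix v)ᵀ * X * (invSqrt M * modeMatrix v)
        = (modeMatrix v)ᵀ * (invSqrt M * X * invSqrt M * modeMatrix v) := by
    rw [transpose_mul, ← conjTranspose_eq_transpose_of_trivial (invSqrt M),
      (isHermitian_invSqrt M).eq]
    simp only [mul_assoc]
  constructor
  · rw [hcongr, invSqrt_mul_mul_invSqrt hM, one_mul, hV]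
  · rw [hcongr, ← normalizedStiffness, mul_modeMatrix hPv, ← mul_assoc, hV, one_mul]

lemma IsModalBasis.modalStack_mul_transpose {M K U : Matrix (Fin n) (Fin n) ℝ} {σ : Fin n → ℝ}
    (hU : IsModalBasis M K U σ) : modalStack q U * (modalStack q (Mᵀ * U))ᵀ = 1 := by
  have hinv : U * (Mᵀ * U)ᵀ = 1 := by
    rw [mul_eq_one_comm, transpose_mul, transpose_transpose, hU.mass]
  rw [OscArray.modalStack_mul_transpose, hinv, one_kronecker_one]

theorem synchronizes_of_forall_undamped_modal_vector {M K U : Matrix (Fin n) (Fin n) ℝ}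
    {D R : Fin q → Fin q → Matrix (Fin n) (Fin n) ℝ} (hM : M.PosDef) (hK : K.PosDef)
    (hD : IsCouplingWeight D) (hR : IsCouplingWeight R) {σ : Fin n → ℝ}
    (hU : IsModalBasis M K U σ)
    (hmode : ∀ (ν : ℝ) (z : Fin n × Fin q → ℝ),
      (diagonal (fun p => σ p.1) + (modalStack q U)ᵀ * lap R * modalStack q U) *ᵥ z = ν • z →
      ((modalStack q U)ᵀ * lap D * modalStack q U) *ᵥ z = 0 → (∀ k, ∑ i, z (k, i) = 0) → z = 0) :
    Synchronizes M K D R := by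
  refine synchronizes_of_forall_undamped_mode hM hK hD hR fun ν u hu hDu hsum => ?_
  obtain ⟨z, hz⟩ : ∃ z, z = (modalStack q (Mᵀ * U))ᵀ *ᵥ u := ⟨_, rfl⟩
  have huz : modalStack q U *ᵥ z = u := by
    rw [hz, mulVec_mulVec, hU.modalStack_mul_transpose, one_mulVec]
  have hstiff := transpose_modalStack_mul_one_kronecker_mul (q := q) hU.stiffness
  have hmass := transpose_modalStack_mul_one_kronecker_mul (q := q)
    (hU.mass.trans diagonal_one.symm)
  rw [diagonal_one] at hmass
  rw [← huz, hmode ν z ?_ ?_ ?_, mulVec_zero]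
  · rw [← hstiff, ← Matrix.add_mul, ← Matrix.mul_add, ← mulVec_mulVec, ← mulVec_mulVec, huz, hu,
      mulVec_smul, ← huz, mulVec_mulVec, mulVec_mulVec, hmass, one_mulVec]
  · rw [← mulVec_mulVec, ← mulVec_mulVec, huz, hDu, mulVec_zero]
  · rw [hz]
    exact sum_transpose_modalStack_mulVec hsum _

lemma eq_zero_of_lap_eq_zero {W : Fin q → Fin q → Matrix (Fin n) (Fin n) ℝ}
    (hdiag : ∀ i, W i i = 0) (h : lap W = 0) (i j : Fin q) : W i j = 0 := by
  rcases eq_or_ne i j with rfl | hij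
  · exact hdiag i
  · have := lap_submatrix W i j
    rw [h, if_neg hij, eq_comm, neg_eq_iff_eq_neg] at this
    exact this.trans neg_zero

lemma IsModalBasis.eq_zero_of_congr_eq_zero {M K U : Matrix (Fin n) (Fin n) ℝ} {σ : Fin n → ℝ}
    (hU : IsModalBasis M K U σ) {L : Matrix (Fin q × Fin n) (Fin q × Fin n) ℝ}
    (h : (modalStack q U)ᵀ * L * modalStack q U = 0) : L = 0 := by
  have hinv := hU.modalStack_mul_transpose (q := q)
  have hinv' : modalStack q (Mᵀ * U) * (modalStack q U)ᵀ = 1 := by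
    rw [← transpose_transpose (modalStack q (Mᵀ * U)), ← transpose_mul, hinv, transpose_one]
  calc L = modalStack q (Mᵀ * U) * ((modalStack q U)ᵀ * L * modalStack q U)
        * (modalStack q (Mᵀ * U))ᵀ := by
        rw [← Matrix.mul_assoc, ← Matrix.mul_assoc, hinv', Matrix.one_mul, Matrix.mul_assoc, hinv,
          Matrix.mul_one]
    _ = 0 := by rw [h, Matrix.mul_zero, Matrix.zero_mul]

lemma exists_diagBlock_ne_zero {κ ι : Type*} [Finite κ] [Finite ι]
    {X : Matrix (κ × ι) (κ × ι) ℝ} (hX : X.PosSemidef) (hX0 : X ≠ 0) :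
    ∃ k, diagBlock X k ≠ 0 := by
  have := Fintype.ofFinite κ
  have := Fintype.ofFinite ι
  by_contra! h
  refine hX0 (hX.trace_eq_zero_iff.1 ?_)
  rw [trace, Fintype.sum_prod_type]
  exact Finset.sum_eq_zero fun k _ => Finset.sum_eq_zero fun i _ => congrFun (congrFun (h k) i) i

lemma modalMatrix_couplingLap_ne_zero {M K : Matrix (Fin n) (Fin n) ℝ} {σ : Fin n → ℝ}
    {v : Fin n → EuclideanSpace ℝ (Fin n)}
    (hU : IsModalBasis M K (invSqrt M * modeMatrix v) σ)
    {W : Fin q → Fin q → Matrix (Fin n) (Fin n) ℝ} (hdiag : ∀ i, W i i = 0)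
    (hW : ∃ i j, W i j ≠ 0) : modalMatrix (couplingLap M W) v ≠ 0 := by
  intro h
  obtain ⟨i, j, hij⟩ := hW
  rw [modalMatrix_couplingLap] at h
  exact hij (eq_zero_of_lap_eq_zero hdiag (hU.eq_zero_of_congr_eq_zero h) i j)

end ModalCoordinates

/-! ### The second eigenvalue of the admittance matrix -/

section Admittance

open scoped ComplexOrder

lemma getD_le_of_lt_countP {α : Type*} [LinearOrder α] {l : List α} (hl : l.Pairwise (· ≤ ·))
    {k : ℕ} {r : α} (h : k < l.countP (· ≤ r)) (d : α) : l.getD k d ≤ r := by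
  induction l generalizing k with
  | nil => simp at h
  | cons x t ih =>
    obtain ⟨hx, ht⟩ := List.pairwise_cons.1 hl
    cases k with
    | succ k => exact ih ht (by grind)
    | zero =>
      obtain ⟨y, hy, hyr⟩ := List.countP_pos_iff.1 h
      have hyr : y ≤ r := of_decide_eq_true hyr
      rcases List.mem_cons.1 hy with rfl | hyt
      exacts [hyr, (hx y hyt).trans hyr]

lemma pair_le_roots_charpoly {ι F : Type*} [Fintype ι] [DecidableEq ι] [Field F]
    {X : Matrix ι ι F} {u w : ι → F} {a b : F} (huw : LinearIndependent F ![u, w])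
    (hu : X *ᵥ u = a • u) (hw : X *ᵥ w = b • w) : {a, b} ≤ X.charpoly.roots := by
  classical
  have hmult (d : F) : Module.finrank F (Module.End.eigenspace (toLin' X) d)
      ≤ X.charpoly.roots.count d := by
    rw [Polynomial.count_roots, ← charpoly_toLin']
    exact LinearMap.finrank_eigenspace_le _ d
  have hmem {d : F} {x : ι → F} (hx : X *ᵥ x = d • x) :
      x ∈ Module.End.eigenspace (toLin' X) d :=
    Module.End.mem_eigenspace_iff.2 hx
  rcases eq_or_ne a b with rfl | hab
  · have hind : LinearIndependent F
        (![⟨u, hmem hu⟩, ⟨w, hmem hw⟩] : Fin 2 → Module.End.eigenspace (toLin' X) a) := by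
      rw [LinearIndependent.pair_iff] at huw ⊢
      exact fun s t hst => huw s t (congrArg Subtype.val hst)
    change Multiset.replicate 2 a ≤ _
    refine Multiset.le_count_iff_replicate_le.1 (le_trans ?_ (hmult a))
    simpa using hind.fintype_card_le_finrank
  · have hroot {d : F} {x : ι → F} (hx : X *ᵥ x = d • x) (hx0 : x ≠ 0) :
        d ∈ X.charpoly.roots :=
      Multiset.count_pos.1 <| (Module.finrank_pos_iff_exists_ne_zero.2
        ⟨⟨x, hmem hx⟩, fun h => hx0 (congrArg Subtype.val h)⟩).trans_le (hmult d)
    rw [Multiset.le_iff_subset (by simpa using hab)]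
    intro d hd
    rcases (by simpa using hd : d = a ∨ d = b) with rfl | rfl
    exacts [hroot hu (huw.ne_zero 0), hroot hw (huw.ne_zero 1)]

lemma reEigenvalue_two_le {m : ℕ} {X : Matrix (Fin m) (Fin m) ℂ} {a b : ℂ} {r : ℝ}
    (h : {a, b} ≤ X.charpoly.roots) (ha : a.re ≤ r) (hb : b.re ≤ r) : reEigenvalue X 2 ≤ r := by
  refine getD_le_of_lt_countP (Multiset.pairwise_sort _ _) ?_ 0
  rw [← Multiset.coe_countP, Multiset.sort_eq]
  have hcount : 2 = (Multiset.map Complex.re {a, b}).countP (· ≤ r) := by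
    simp [Multiset.countP_eq_card_filter, Multiset.filter_singleton, ha, hb]
  exact hcount.trans_le (Multiset.countP_le_of_le _ (Multiset.map_le_map h))

variable {q : ℕ} {G B : Matrix (Fin q) (Fin q) ℝ} {w : EuclideanSpace ℂ (Fin q)}

lemma ne_zero_of_mem_unitEigenvectors (hw : w ∈ unitEigenvectors B) : w.ofLp ≠ 0 := fun h =>
  one_ne_zero (hw.1.symm.trans (norm_eq_zero.2 ((WithLp.ofLp_eq_zero 2).1 h)))

lemma exists_mulVec_eq_of_mem_unitEigenvectors (hw : w ∈ unitEigenvectors B) :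
    ∃ μ : ℝ, B.map Complex.ofReal *ᵥ w.ofLp = (μ : ℂ) • w.ofLp := by
  obtain ⟨-, ⟨μ, hμ⟩, -⟩ := hw
  exact ⟨μ, by rwa [sub_mulVec, smul_mulVec, one_mulVec, sub_eq_zero] at hμ⟩

lemma sum_eq_zero_of_mem_unitEigenvectors (hw : w ∈ unitEigenvectors B) : ∑ i, w i = 0 := by
  obtain ⟨-, -, hsum⟩ := hw
  rcases eq_or_ne q 0 with rfl | hq
  · simp
  · simp only [oneVec, dotProduct, ← Finset.mul_sum] at hsum
    exact (mul_eq_zero.1 hsum).resolve_left (by simpa using hq)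

lemma linearIndependent_one_of_sum_eq_zero {ι F : Type*} [Fintype ι] [Field F] [CharZero F]
    {w : ι → F} (hw : w ≠ 0) (hsum : ∑ i, w i = 0) : LinearIndependent F ![1, w] := by
  obtain ⟨i, -⟩ := Function.ne_iff.1 hw
  have : Nonempty ι := ⟨i⟩
  rw [LinearIndependent.pair_iff]
  intro s t hst
  have hs : s = 0 := by
    have := congrArg (fun z => ∑ i, z i) hst
    simpa [Finset.sum_add_distrib, ← Finset.mul_sum, hsum] using this
  rw [hs, zero_smul, zero_add] at hst
  exact ⟨hs, (smul_eq_zero.1 hst).resolve_right hw⟩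

lemma admittance_mulVec (x : Fin q → ℂ) : admittance G B *ᵥ x
    = G.map Complex.ofReal *ᵥ x + Complex.I • B.map Complex.ofReal *ᵥ x := by
  rw [admittance, add_mulVec, smul_mulVec]

lemma map_ofReal_mulVec_one (hG : G *ᵥ 1 = 0) : G.map Complex.ofReal *ᵥ 1 = 0 := by
  have := map_ofReal_mulVec_ofReal G 1
  rw [hG] at this
  simpa [Pi.one_def, Pi.zero_def] using this

lemma re_dotProduct_pos_of_mem_unitEigenvectors (hG : G.PosSemidef) (hG1 : G *ᵥ 1 = 0)
    (hB1 : B *ᵥ 1 = 0) (hlam : 0 < reEigenvalue (admittance G B) 2)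
    (hw : w ∈ unitEigenvectors B) :
    0 < (star w.ofLp ⬝ᵥ G.map Complex.ofReal *ᵥ w.ofLp).re := by
  have hGc := posSemidef_map_ofReal hG
  refine Complex.pos_iff.1 ((hGc.dotProduct_mulVec_nonneg _).lt_of_ne' fun h => ?_) |>.1
  rw [hGc.dotProduct_mulVec_zero_iff] at h
  obtain ⟨μ, hμ⟩ := exists_mulVec_eq_of_mem_unitEigenvectors hw
  have hone : admittance G B *ᵥ 1 = (0 : ℂ) • 1 := by
    rw [admittance_mulVec, map_ofReal_mulVec_one hG1, map_ofReal_mulVec_one hB1]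
    simp
  have heigen : admittance G B *ᵥ w.ofLp = (Complex.I * μ) • w.ofLp := by
    rw [admittance_mulVec, h, hμ, zero_add, smul_smul]
  have hpair := pair_le_roots_charpoly
    (linearIndependent_one_of_sum_eq_zero (ne_zero_of_mem_unitEigenvectors hw)
      (sum_eq_zero_of_mem_unitEigenvectors hw)) hone heigen
  exact hlam.not_ge (reEigenvalue_two_le hpair (by simp) (by simp))

end Admittance

/-! ### The constants of the coupling bound -/

section Constants

open scoped ComplexOrder

lemma csInf_pos_of_finite {s : Set ℝ} (hs : s.Finite) (hne : s.Nonempty)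
    (h : ∀ x ∈ s, 0 < x) : 0 < sInf s :=
  h _ (hne.csInf_mem hs)

variable {q n : ℕ}

lemma two_mul_sigmaBar_le (σ : Fin n → ℝ) {k l : Fin n} (h : k ≠ l) :
    2 * sigmaBar σ ≤ |σ k - σ l| := by
  rw [sigmaBar, ← mul_assoc, mul_one_div_cancel two_ne_zero, one_mul]
  exact csInf_le ⟨0, by rintro _ ⟨k, l, -, rfl⟩; exact abs_nonneg _⟩ ⟨k, l, h, rfl⟩

lemma sigmaBar_pos {σ : Fin n → ℝ} (hσ : Function.Injective σ) (hn : 2 ≤ n) :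
    0 < sigmaBar σ := by
  refine mul_pos one_half_pos (csInf_pos_of_finite ?_ ?_ ?_)
  · refine (Set.finite_range fun p : Fin n × Fin n => |σ p.1 - σ p.2|).subset ?_
    rintro _ ⟨k, l, -, rfl⟩
    exact ⟨(k, l), rfl⟩
  · exact ⟨_, ⟨0, by omega⟩, ⟨1, by omega⟩, by simp, rfl⟩
  · rintro _ ⟨k, l, h, rfl⟩
    exact abs_pos.2 (sub_ne_zero.2 (hσ.ne h))

lemma two_mul_muBar_le (B : Fin n → Matrix (Fin q) (Fin q) ℝ) {k : Fin n} {a b : ℝ}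
    (ha : a ∈ spectrum ℝ (B k)) (hb : b ∈ spectrum ℝ (B k)) (hab : a ≠ b) :
    2 * muBar B ≤ |a - b| := by
  rw [muBar, ← mul_assoc, mul_one_div_cancel two_ne_zero, one_mul]
  exact csInf_le ⟨0, by rintro _ ⟨k, a, -, b, -, -, rfl⟩; exact abs_nonneg _⟩
    ⟨k, a, ha, b, hb, hab, rfl⟩

lemma muBar_pos {B : Fin n → Matrix (Fin q) (Fin q) ℝ}
    (hB : ∃ k, (spectrum ℝ (B k)).Nontrivial) : 0 < muBar B := by
  refine mul_pos one_half_pos (csInf_pos_of_finite ?_ ?_ ?_)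
  · refine (Set.finite_iUnion fun k => ((finite_real_spectrum (A := B k)).prod
      (finite_real_spectrum (A := B k))).image fun p => |p.1 - p.2|).subset ?_
    rintro _ ⟨k, a, ha, b, hb, -, rfl⟩
    exact Set.mem_iUnion.2 ⟨k, (a, b), ⟨ha, hb⟩, rfl⟩
  · obtain ⟨k, a, ha, b, hb, hab⟩ := hB
    exact ⟨_, k, a, ha, b, hb, hab, rfl⟩
  · rintro _ ⟨k, a, -, b, -, hab, rfl⟩
    exact abs_pos.2 (sub_ne_zero.2 hab)

lemma isCompact_unitEigenvectors (B : Matrix (Fin q) (Fin q) ℝ) :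
    IsCompact (unitEigenvectors B) := by
  let rayleigh (w : EuclideanSpace ℂ (Fin q)) : ℝ :=
    (star w.ofLp ⬝ᵥ B.map Complex.ofReal *ᵥ w.ofLp).re
  have hset : unitEigenvectors B = Metric.sphere 0 1 ∩
      {w | (B.map Complex.ofReal - (rayleigh w : ℂ) • 1) *ᵥ w.ofLp = 0 ∧
        oneVec q ⬝ᵥ w.ofLp = 0} := by
    ext w
    simp only [unitEigenvectors, Set.mem_inter_iff, mem_sphere_zero_iff_norm, Set.mem_ofPred_eq]
    refine and_congr_right fun hw => and_congr_left fun _ => ⟨?_, fun h => ⟨_, h⟩⟩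
    rintro ⟨μ, hμ⟩
    have hBw : B.map Complex.ofReal *ᵥ w.ofLp = (μ : ℂ) • w.ofLp := by
      rwa [sub_mulVec, smul_mulVec, one_mulVec, sub_eq_zero] at hμ
    have hww : star w.ofLp ⬝ᵥ w.ofLp = 1 := by
      rw [dotProduct_comm, ← EuclideanSpace.inner_eq_star_dotProduct, inner_self_eq_norm_sq_to_K,
        hw]
      simp
    have hrayleigh : rayleigh w = μ := by
      simp only [rayleigh, hBw, dotProduct_smul, hww, smul_eq_mul, mul_one, Complex.ofReal_re]
    rwa [hrayleigh]
  rw [hset]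
  refine (isCompact_sphere _ _).inter_right ?_
  have hofLp : Continuous fun w : EuclideanSpace ℂ (Fin q) => w.ofLp := PiLp.continuous_ofLp 2 _
  have hrayleigh : Continuous rayleigh := Complex.continuous_re.comp <|
    hofLp.star.dotProduct (continuous_const.matrix_mulVec hofLp)
  refine (isClosed_eq ?_ continuous_const).inter
    (isClosed_eq (continuous_const.dotProduct hofLp) continuous_const)
  exact (continuous_const.sub ((Complex.continuous_ofReal.comp hrayleigh).smul
    continuous_const)).matrix_mulVec hofLp

lemma gammaBar_sq_le {G B : Fin n → Matrix (Fin q) (Fin q) ℝ} (hG : ∀ k, (G k).PosSemidef)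
    {k : Fin n} {w : EuclideanSpace ℂ (Fin q)} (hw : w ∈ unitEigenvectors (B k)) :
    gammaBar G B ^ 2 ≤ (star w.ofLp ⬝ᵥ (G k).map Complex.ofReal *ᵥ w.ofLp).re := by
  have hnonneg (k : Fin n) (w : EuclideanSpace ℂ (Fin q)) :
      0 ≤ (star w.ofLp ⬝ᵥ (G k).map Complex.ofReal *ᵥ w.ofLp).re :=
    (Complex.nonneg_iff.1 ((posSemidef_map_ofReal (hG k)).dotProduct_mulVec_nonneg _)).1
  rw [gammaBar, Real.sq_sqrt]
  · exact csInf_le ⟨0, by rintro _ ⟨k, w, -, rfl⟩; exact hnonneg k w⟩ ⟨k, w, hw, rfl⟩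
  · exact Real.sInf_nonneg (by rintro _ ⟨k, w, -, rfl⟩; exact hnonneg k w)

lemma gammaBar_pos {G B : Fin n → Matrix (Fin q) (Fin q) ℝ}
    (hne : ∃ k, (unitEigenvectors (B k)).Nonempty)
    (hpos : ∀ k, ∀ w ∈ unitEigenvectors (B k),
      0 < (star w.ofLp ⬝ᵥ (G k).map Complex.ofReal *ᵥ w.ofLp).re) : 0 < gammaBar G B := by
  let rayleigh (k : Fin n) (w : EuclideanSpace ℂ (Fin q)) : ℝ :=
    (star w.ofLp ⬝ᵥ (G k).map Complex.ofReal *ᵥ w.ofLp).re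
  have hset : {c | ∃ k, ∃ w ∈ unitEigenvectors (B k), c = rayleigh k w}
      = ⋃ k, rayleigh k '' unitEigenvectors (B k) := by
    ext c
    simp [eq_comm]
  have hofLp : Continuous fun w : EuclideanSpace ℂ (Fin q) => w.ofLp := PiLp.continuous_ofLp 2 _
  have hcompact : IsCompact {c | ∃ k, ∃ w ∈ unitEigenvectors (B k), c = rayleigh k w} := by
    rw [hset]
    exact isCompact_iUnion fun k => (isCompact_unitEigenvectors (B k)).image <|
      Complex.continuous_re.comp (hofLp.star.dotProduct (continuous_const.matrix_mulVec hofLp))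
  obtain ⟨k, w, hw⟩ := hne
  obtain ⟨k', w', hw', hmin⟩ := hcompact.sInf_mem ⟨_, k, w, hw, rfl⟩
  exact Real.sqrt_pos.2 ((hpos k' w' hw').trans_eq hmin.symm)

lemma ofReal_normalize_mem_unitEigenvectors {B : Matrix (Fin q) (Fin q) ℝ}
    {w : EuclideanSpace ℝ (Fin q)} (hw : w ≠ 0) {μ : ℝ} (hμ : B *ᵥ w.ofLp = μ • w.ofLp)
    (hsum : ∑ i, w i = 0) :
    (WithLp.toLp 2 fun i => (((‖w‖⁻¹ • w) i : ℝ) : ℂ)) ∈ unitEigenvectors B := by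
  refine ⟨?_, ⟨μ, ?_⟩, ?_⟩
  · have hnorm : ‖‖w‖⁻¹ • w‖ = 1 := norm_smul_inv_norm hw
    rw [EuclideanSpace.norm_eq] at hnorm ⊢
    simpa only [Complex.norm_real] using hnorm
  · rw [sub_mulVec, map_ofReal_mulVec_ofReal, smul_mulVec, one_mulVec, sub_eq_zero]
    ext i
    simp [mulVec_smul, hμ, mul_left_comm]
  · simp [oneVec, dotProduct, ← Finset.mul_sum, ← Complex.ofReal_sum, hsum]

lemma gammaBar_sq_mul_norm_sq_le {G B : Fin n → Matrix (Fin q) (Fin q) ℝ}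
    (hG : ∀ k, (G k).PosSemidef) {k : Fin n} {w : EuclideanSpace ℝ (Fin q)} {μ : ℝ}
    (hμ : B k *ᵥ w.ofLp = μ • w.ofLp) (hsum : ∑ i, w i = 0) :
    gammaBar G B ^ 2 * ‖w‖ ^ 2 ≤ w.ofLp ⬝ᵥ G k *ᵥ w.ofLp := by
  rcases eq_or_ne w 0 with rfl | hw
  · simp
  have hreal : (star (fun i => (((‖w‖⁻¹ • w) i : ℝ) : ℂ)) ⬝ᵥ
      (G k).map Complex.ofReal *ᵥ fun i => (((‖w‖⁻¹ • w) i : ℝ) : ℂ)).re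
      = (w.ofLp ⬝ᵥ G k *ᵥ w.ofLp) / ‖w‖ ^ 2 := by
    have hofReal (x y : Fin q → ℝ) :
        (star (fun i => (x i : ℂ)) ⬝ᵥ fun i => (y i : ℂ)).re = x ⬝ᵥ y := by
      simp [dotProduct]
    rw [map_ofReal_mulVec_ofReal, hofReal, WithLp.ofLp_smul, mulVec_smul, dotProduct_smul,
      smul_dotProduct, smul_eq_mul, smul_eq_mul]
    field_simp
  have hle := gammaBar_sq_le hG (ofReal_normalize_mem_unitEigenvectors hw hμ hsum)
  rw [hreal] at hle
  exact (le_div_iff₀ (by positivity)).1 hle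

lemma sum_eq_zero_of_mulVec_eq {ι : Type*} [Fintype ι] {X : Matrix ι ι ℝ} (hX : X.IsHermitian)
    (hX1 : X *ᵥ 1 = 0) {w : ι → ℝ} {c : ℝ} (hc : X *ᵥ w = c • w) (hc0 : c ≠ 0) :
    ∑ i, w i = 0 := by
  have hsum : c * ∑ i, w i = 0 := by
    rw [← one_dotProduct, ← smul_eq_mul, ← dotProduct_smul, ← hc, dotProduct_mulVec,
      ← mulVec_transpose, ← conjTranspose_eq_transpose_of_trivial, hX.eq, hX1, zero_dotProduct]
  exact (mul_eq_zero.1 hsum).resolve_left hc0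

lemma mem_spectrum_of_mulVec_eq {ι F : Type*} [Fintype ι] [DecidableEq ι] [Field F]
    {X : Matrix ι ι F} {w : ι → F} (hw : w ≠ 0) {c : F} (hc : X *ᵥ w = c • w) :
    c ∈ spectrum F X := by
  rw [← spectrum_toLin']
  exact (Module.End.hasEigenvalue_of_hasEigenvector
    ⟨Module.End.mem_eigenspace_iff.2 hc, hw⟩).mem_spectrum

lemma spectrum_nontrivial {ι : Type*} [Fintype ι] [DecidableEq ι] {X : Matrix ι ι ℝ}
    (hX : X.IsHermitian) (hX1 : X *ᵥ 1 = 0) (hX0 : X ≠ 0) : (spectrum ℝ X).Nontrivial := by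
  obtain ⟨w, c, hc0, hw0, hw⟩ := hX.exists_eigenvector_of_ne_zero hX0
  obtain ⟨i, -⟩ := Function.ne_iff.1 hw0
  have : Nonempty ι := ⟨i⟩
  exact ⟨c, mem_spectrum_of_mulVec_eq hw0 hw, 0,
    mem_spectrum_of_mulVec_eq one_ne_zero (by rw [hX1, zero_smul]), hc0⟩

lemma unitEigenvectors_nonempty {X : Matrix (Fin q) (Fin q) ℝ} (hX : X.IsHermitian)
    (hX1 : X *ᵥ 1 = 0) (hX0 : X ≠ 0) : (unitEigenvectors X).Nonempty := by
  obtain ⟨w, c, hc0, hw0, hw⟩ := hX.exists_eigenvector_of_ne_zero hX0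
  exact ⟨_, ofReal_normalize_mem_unitEigenvectors (w := WithLp.toLp 2 w)
    (fun h => hw0 (congrArg WithLp.ofLp h)) hw (sum_eq_zero_of_mulVec_eq hX hX1 hw hc0)⟩

end Constants

/-! ### The coupling threshold -/

section CouplingThreshold

variable {q n : ℕ}

lemma exists_spectrum_nontrivial_and_unitEigenvectors_nonempty
    {M K : Matrix (Fin n) (Fin n) ℝ} {R : Fin q → Fin q → Matrix (Fin n) (Fin n) ℝ}
    (hR : IsCouplingWeight R) (hRne : ∃ i j, R i j ≠ 0) {σ : Fin n → ℝ}
    {v : Fin n → EuclideanSpace ℝ (Fin n)}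
    (hU : IsModalBasis M K (invSqrt M * modeMatrix v) σ) :
    ∃ k, (spectrum ℝ (modalBlock (couplingLap M R) v k k)).Nontrivial ∧
      (unitEigenvectors (modalBlock (couplingLap M R) v k k)).Nonempty := by
  obtain ⟨k, hk⟩ := exists_diagBlock_ne_zero (hR.posSemidef_modalMatrix_couplingLap M v)
    (modalMatrix_couplingLap_ne_zero hU hR.diag hRne)
  have hBk := (hR.posSemidef_modalBlock_couplingLap M v k).isHermitian
  have hBk1 := hR.modalBlock_couplingLap_mulVec_one M v k k
  exact ⟨k, spectrum_nontrivial hBk hBk1 hk, unitEigenvectors_nonempty hBk hBk1 hk⟩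

lemma lap_smul (c : ℝ) (W : Fin q → Fin q → Matrix (Fin n) (Fin n) ℝ) :
    lap (fun i j => c • W i j) = c • lap W := by
  ext p r
  simp only [lap, of_apply, ← Finset.smul_sum, Matrix.smul_apply, smul_neg, smul_ite]

theorem synchronizes_smul_of_mul_lt {M K : Matrix (Fin n) (Fin n) ℝ}
    {D R : Fin q → Fin q → Matrix (Fin n) (Fin n) ℝ} (hM : M.PosDef) (hK : K.PosDef)
    (hD : IsCouplingWeight D) (hR : IsCouplingWeight R) {σ : Fin n → ℝ}
    {v : Fin n → EuclideanSpace ℝ (Fin n)} (hU : IsModalBasis M K (invSqrt M * modeMatrix v) σ)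
    {s m γ ε : ℝ} (hs : 0 < s) (hσ : ∀ k l, k ≠ l → 2 * s ≤ |σ k - σ l|)
    (hm : m = muBar fun k => modalBlock (couplingLap M R) v k k) (hm0 : 0 < m)
    (hγ : γ = gammaBar (fun k => modalBlock (couplingLap M D) v k k)
      (fun k => modalBlock (couplingLap M R) v k k)) (hγ0 : 0 < γ) (hε : 0 < ε)
    (hsmall : ε * norm2 (modalMatrix (couplingLap M R) v)
      * (m + norm2 (modalMatrix (couplingLap M R) v))
      * (√(norm2 (modalMatrix (couplingLap M D) v)) + γ) < γ * s * m) :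
    Synchronizes M K D (fun i j => ε • R i j) := by
  refine synchronizes_of_forall_undamped_modal_vector hM hK hD (hR.smul hε.le) hU
    fun ν z hz hDz hsum => ?_
  rw [lap_smul, Matrix.mul_smul, Matrix.smul_mul, ← modalMatrix_couplingLap] at hz
  rw [← modalMatrix_couplingLap] at hDz
  subst hm hγ
  exact eq_zero_of_undamped_mode (hD.posSemidef_modalMatrix_couplingLap M v).isHermitian
    (hR.posSemidef_modalMatrix_couplingLap M v).isHermitian hs hm0 hγ0 hε hσ
    (fun k a ha b hb => two_mul_muBar_le _ ha hb)
    (fun k => hR.modalBlock_couplingLap_mulVec_one M v k k)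
    (fun k w β => gammaBar_sq_mul_norm_sq_le
      fun k => hD.posSemidef_modalBlock_couplingLap M v k) hsmall hz hDz hsum

lemma one_le_sqrt_sub_one {n : ℕ} (hn : 2 ≤ n) : 1 ≤ √((n : ℝ) - 1) := by
  have : (2 : ℝ) ≤ n := by exact_mod_cast hn
  exact Real.one_le_sqrt.2 (by linarith)

variable {Ld Lr : Matrix (Fin q × Fin n) (Fin q × Fin n) ℝ} {σ : Fin n → ℝ}
  {v : Fin n → EuclideanSpace ℝ (Fin n)}

lemma couplingBound_pos (hn : 2 ≤ n)
    (hγ : 0 < gammaBar (fun k => modalBlock Ld v k k) (fun k => modalBlock Lr v k k))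
    (hs : 0 < sigmaBar σ) (hm : 0 < muBar fun k => modalBlock Lr v k k)
    (hb : 0 < norm2 (modalMatrix Lr v)) : 0 < couplingBound Ld Lr σ v := by
  have := one_le_sqrt_sub_one hn
  have := Real.sqrt_nonneg (norm2 (modalMatrix Ld v))
  unfold couplingBound
  positivity

lemma mul_lt_of_lt_couplingBound (hn : 2 ≤ n)
    (hγ : 0 < gammaBar (fun k => modalBlock Ld v k k) (fun k => modalBlock Lr v k k))
    (hm : 0 < muBar fun k => modalBlock Lr v k k) (hb : 0 < norm2 (modalMatrix Lr v))
    {ε : ℝ} (hε : 0 < ε) (h : ε < couplingBound Ld Lr σ v) :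
    ε * norm2 (modalMatrix Lr v)
        * ((muBar fun k => modalBlock Lr v k k) + norm2 (modalMatrix Lr v))
        * (√(norm2 (modalMatrix Ld v))
          + gammaBar (fun k => modalBlock Ld v k k) (fun k => modalBlock Lr v k k))
      < gammaBar (fun k => modalBlock Ld v k k) (fun k => modalBlock Lr v k k) * sigmaBar σ
        * muBar fun k => modalBlock Lr v k k := by
  unfold couplingBound at h
  set γ := gammaBar (fun k => modalBlock Ld v k k) (fun k => modalBlock Lr v k k)
  set m := muBar fun k => modalBlock Lr v k k
  set b := norm2 (modalMatrix Lr v)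
  set g := √(norm2 (modalMatrix Ld v))
  have hc := one_le_sqrt_sub_one hn
  set c := √((n : ℝ) - 1)
  calc ε * b * (m + b) * (g + γ) ≤ ε * b * (m + b) * ((g + 2 * γ) * c) := by
        gcongr
        exact (by linarith : g + γ ≤ g + 2 * γ).trans (le_mul_of_one_le_right (by positivity) hc)
    _ = ε * ((g + 2 * γ) * c * b * (m + b)) := by ring
    _ < γ * sigmaBar σ * m := (lt_div_iff₀ (by positivity)).1 h

lemma exists_pos_lt_mul_mul {γ m : ℝ} (hγ : 0 < γ) (hm : 0 < m) (x : ℝ) :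
    ∃ s, 0 < s ∧ x < γ * s * m := by
  have htop : Tendsto (fun s => γ * s * m) atTop atTop :=
    (tendsto_id.const_mul_atTop hγ).atTop_mul_const hm
  exact ((eventually_gt_atTop 0).and (htop.eventually_gt_atTop x)).exists

end CouplingThreshold

end OscArray

theorem mainTheorem2 {q n : ℕ} (M K : Matrix (Fin n) (Fin n) ℝ)
    (D R : Fin q → Fin q → Matrix (Fin n) (Fin n) ℝ)
    (hM : M.PosDef) (hK : K.PosDef)
    (hD : ∀ i j, (D i j).PosSemidef) (hDsymm : ∀ i j, D i j = D j i) (hDdiag : ∀ i, D i i = 0)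
    (hR : ∀ i j, (R i j).PosSemidef) (hRsymm : ∀ i j, R i j = R j i) (hRdiag : ∀ i, R i i = 0)
    (hRne : ∃ i j, R i j ≠ 0)
    -- the eigenvalues of `P = M^{-1/2} K M^{-1/2}`, distinct, with unit eigenvectors
    (σ : Fin n → ℝ) (v : Fin n → EuclideanSpace ℝ (Fin n))
    (hσ : Function.Injective σ) (hv : ∀ k, ‖v k‖ = 1)
    (hPv : ∀ k, OscArray.normalizedStiffness M K *ᵥ (v k).ofLp = σ k • (v k).ofLp)
    (hlam : ∀ k, 0 < OscArray.reEigenvalue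
      (OscArray.admittance (OscArray.modalBlock (OscArray.couplingLap M D) v k k)
        (OscArray.modalBlock (OscArray.couplingLap M R) v k k)) 2) :
    (∃ r : ℝ, 0 < r ∧ ∀ ε ∈ Set.Ioo 0 r,
      OscArray.Synchronizes M K D (fun i j => ε • R i j)) ∧
    (2 ≤ n →
      0 < OscArray.couplingBound (OscArray.couplingLap M D) (OscArray.couplingLap M R) σ v ∧
      ∀ ε ∈ Set.Ioo 0
          (OscArray.couplingBound (OscArray.couplingLap M D) (OscArray.couplingLap M R) σ v),
        OscArray.Synchronizes M K D (fun i j => ε • R i j)) ∧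
    (n = 1 → ∀ ε : ℝ, 0 < ε → OscArray.Synchronizes M K D (fun i j => ε • R i j)) := by
  open OscArray in
  have hD' : IsCouplingWeight D := ⟨hD, hDsymm, hDdiag⟩
  have hR' : IsCouplingWeight R := ⟨hR, hRsymm, hRdiag⟩
  have hU := isModalBasis_invSqrt_mul_modeMatrix hM hK.isHermitian hσ hv hPv
  obtain ⟨k, hspec, hunit⟩ := exists_spectrum_nontrivial_and_unitEigenvectors_nonempty hR' hRne hU
  have hb := norm2_pos (modalMatrix_couplingLap_ne_zero hU hRdiag hRne)
  have hm : 0 < muBar fun k => modalBlock (couplingLap M R) v k k := muBar_pos ⟨k, hspec⟩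
  have hγ : 0 < gammaBar (fun k => modalBlock (couplingLap M D) v k k)
      (fun k => modalBlock (couplingLap M R) v k k) :=
    gammaBar_pos ⟨k, hunit⟩ fun k _ => re_dotProduct_pos_of_mem_unitEigenvectors
      (hD'.posSemidef_modalBlock_couplingLap M v k) (hD'.modalBlock_couplingLap_mulVec_one M v k k)
      (hR'.modalBlock_couplingLap_mulVec_one M v k k) (hlam k)
  have large (hn : 2 ≤ n) := And.intro (couplingBound_pos hn hγ (sigmaBar_pos hσ hn) hm hb)
    fun ε (hε : ε ∈ Set.Ioo 0 _) => synchronizes_smul_of_mul_lt hM hK hD' hR' hU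
      (sigmaBar_pos hσ hn) (fun _ _ => two_mul_sigmaBar_le σ) rfl hm rfl hγ hε.1
      (mul_lt_of_lt_couplingBound hn hγ hm hb hε.1 hε.2)
  have single (hn : n = 1) (ε : ℝ) (hε : 0 < ε) : Synchronizes M K D fun i j => ε • R i j := by
    obtain ⟨s, hs, hsmall⟩ := exists_pos_lt_mul_mul hγ hm _
    exact synchronizes_smul_of_mul_lt hM hK hD' hR' hU hs
      (fun k l hkl => absurd (Fin.ext (by omega)) hkl) rfl hm rfl hγ hε hsmall
  refine ⟨?_, large, single⟩
  rcases (Nat.succ_le_of_lt k.pos).eq_or_lt with hn | hn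
  · exact ⟨1, one_pos, fun ε hε => single hn.symm ε hε.1⟩
  · exact ⟨_, large hn⟩
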